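/- Let $\Gamma$ be a countable discrete group, let $\Delta\Gamma$ be its Stone–Čech compactification (the space of ultrafilters on $\Gamma$), with the left and right translation actions of $\Gamma$, and let $\partial\Gamma=\Delta\Gamma\setminus\Gamma$. A boundary piece is a closed subset $X\subset\partial\Gamma$ which is invariant under the left and right $\Gamma$-actions. All compact spaces are Hausdorff, all actions on them are continuous, and $\operatorname{Prob}(K)$ denotes the set of regular Borel probability measures on a compact space $K$. For an action $\Gamma\curvearrowright K$ on a compact space and $\eta\in\operatorname{Prob}(K)$, let $\partial_\eta\Gamma$ be the set of all $\omega\in\Delta\Gamma$ such that $\lim_{g\to\omega}\big((gh)\cdot\eta-g\cdot\eta\big)=0$ in the weak-* topology for every $h\in\Gamma$. For a boundary piece $X$, let $C(X)^{\Gamma_r}$ be the C*-algebra of continuous functions $f:X\to\mathbb C$ with $f(\omega h)=f(\omega)$ for all $\omega\in X$, $h\in\Gamma$; let $C(X)^{**}$ be the bidual with its usual C*-algebra structure (Arens product), and $(C(X)^{**})^{\Gamma_r}$ the C*-subalgebra of elements fixed by the second transposes of the right translations. The group $\Gamma$ acts on both algebras by left translations, $(g\cdot f)(\omega)=f(g^{-1}\omega)$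 on $C(X)$ and the second transpose of this on $C(X)^{**}$. Theorem. Let $X\subset\partial\Gamma$ be a non-empty boundary piece. The following are equivalent. (i) There are finitely many actions $\Gamma\curvearrowright K_i$, $i=1,\dots,k$, on compact spaces with $\eta_i\in\operatorname{Prob}(K_i)$, such that no $K_i$ carries a $\Gamma$-invariant measure in $\operatorname{Prob}(K_i)$ and $X\subset\bigcup_{i=1}^k\partial_{\eta_i}\Gamma$. (ii) There is an action $\Gamma\curvearrowright K$ on a compact space with $\eta\in\operatorname{Prob}(K)$, such that $K$ carries no $\Gamma$-invariant measure in $\operatorname{Prob}(K)$ and $X=\partial_\eta\Gamma$. (iii) There is no left-$\Gamma$-invariant state on $C(X)^{\Gamma_r}$. (iv) There is no left-$\Gamma$-invariant state on $(C(X)^{**})^{\Gamma_r}$. Moreover, if $\Gamma$ is infinite, then for $X=\partial\Gamma$ each of these conditions is equivalent to proper proximality of $\Gamma$, that is, to the existence of a finite non-empty family of actions $\Gamma\curvearrowright K_i$ on compact spaces with $\eta_i\in\operatorname{Prob}(K_i)$, such that no $K_i$ carries a $\Gamma$-invariant measure in $\operatorname{Prob}(K_i)$ and $\bigcup_i\partial_{\eta_i}\Gamma=\partial\Gamma$.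 -/

import Mathlib

universe u v w

noncomputable section

open MeasureTheory Filter Topology
open scoped ComplexOrder

/-! ## The Stone–Čech compactification of a discrete group

For a discrete group `Γ`, its Stone–Čech compactification `ΔΓ` is the space `Ultrafilter Γ`
with Mathlib's topology; `Γ` sits in it as the set of principal ultrafilters. -/

section StoneCech

variable {Γ : Type u} [Group Γ]

/-- The Stone–Čech boundary `∂Γ = ΔΓ \ Γ`: the non-principal ultrafilters. -/
def stoneCechBoundary (Γ : Type u) : Set (Ultrafilter Γ) :=
  (Set.range (pure : Γ → Ultrafilter Γ))ᶜ

/-- Left translation `ω ↦ g ω` on `ΔΓ`. -/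
def leftTranslate (g : Γ) (ω : Ultrafilter Γ) : Ultrafilter Γ := ω.map (fun x => g * x)

/-- Right translation `ω ↦ ω g` on `ΔΓ`. -/
def rightTranslate (g : Γ) (ω : Ultrafilter Γ) : Ultrafilter Γ := ω.map (fun x => x * g)

theorem continuous_ultrafilter_map {α β : Type*} (f : α → β) :
    Continuous (Ultrafilter.map f) := by
  refine continuous_generateFrom_iff.2 ?_
  rintro _ ⟨s, rfl⟩
  exact ultrafilter_isOpen_basic (f ⁻¹' s)

theorem map_mem_stoneCechBoundary {α : Type*} (e : α ≃ α) {ω : Ultrafilter α}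
    (hω : ω ∈ stoneCechBoundary α) : ω.map e ∈ stoneCechBoundary α := by
  rintro ⟨x, hx⟩
  refine hω ⟨e.symm x, ?_⟩
  have h := congrArg (Ultrafilter.map e.symm) hx
  rw [Ultrafilter.map_map, Equiv.symm_comp_self, Ultrafilter.map_id] at h
  rw [← h, Ultrafilter.map_pure]

theorem isClosed_stoneCechBoundary (Γ : Type u) : IsClosed (stoneCechBoundary Γ) := by
  rw [stoneCechBoundary, isClosed_compl_iff]
  have h : Set.range (pure : Γ → Ultrafilter Γ) = ⋃ x : Γ, {ω : Ultrafilter Γ | {x} ∈ ω} := by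
    ext ω
    simp only [Set.mem_range, Set.mem_iUnion]
    constructor
    · rintro ⟨x, rfl⟩
      exact ⟨x, by simp⟩
    · rintro ⟨x, hx⟩
      refine ⟨x, Ultrafilter.coe_le_coe.1 ?_ |>.symm⟩
      exact (Filter.le_pure_iff.2 hx)
  rw [h]
  exact isOpen_iUnion fun x => ultrafilter_isOpen_basic _

variable (Γ) in
/-- A boundary piece of `Γ`: a closed subset of `∂Γ` which is invariant under the left and the
right translation actions. -/
structure BoundaryPiece where
  /-- The underlying subset of `ΔΓ`. -/
  carrier : Set (Ultrafilter Γ)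
  isClosed' : IsClosed carrier
  subset_boundary : carrier ⊆ stoneCechBoundary Γ
  left_mem : ∀ (g : Γ), ∀ ω ∈ carrier, leftTranslate g ω ∈ carrier
  right_mem : ∀ (g : Γ), ∀ ω ∈ carrier, rightTranslate g ω ∈ carrier

variable (Γ) in
/-- The whole boundary `∂Γ`, as a boundary piece. -/
def BoundaryPiece.whole : BoundaryPiece Γ where
  carrier := stoneCechBoundary Γ
  isClosed' := isClosed_stoneCechBoundary Γ
  subset_boundary := subset_rfl
  left_mem g _ hω := map_mem_stoneCechBoundary (Equiv.mulLeft g) hω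
  right_mem g _ hω := map_mem_stoneCechBoundary (Equiv.mulRight g) hω

end StoneCech

/-! ## Actions on compact spaces and proximal pieces -/

section Proximal

/-- A continuous action of the discrete group `Γ` on a compact Hausdorff space, together with a
regular Borel probability measure `η` on that space. -/
structure CompactAction (Γ : Type u) [Group Γ] where
  /-- The compact space. -/
  space : Type w
  [topology : TopologicalSpace space]
  [compact : CompactSpace space]
  [hausdorff : T2Space space]
  [measurable : MeasurableSpace space]
  [borel : BorelSpace space]
  [action : MulAction Γ space]
  [continuousAction : ContinuousConstSMul Γ space]
  /-- The probability measure. -/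
  η : Measure space
  [probability : IsProbabilityMeasure η]
  [regular : η.Regular]

attribute [instance] CompactAction.topology CompactAction.compact CompactAction.hausdorff
  CompactAction.measurable CompactAction.borel CompactAction.action
  CompactAction.continuousAction CompactAction.probability CompactAction.regular

variable {Γ : Type u} [Group Γ]

/-- There is a `Γ`-invariant regular Borel probability measure on the compact space. -/
def CompactAction.HasInvariantProbability (A : CompactAction.{u, w} Γ) : Prop :=
  ∃ μ : Measure A.space, IsProbabilityMeasure μ ∧ μ.Regular ∧
    ∀ g : Γ, μ.map (fun x => g • x) = μ

/-- The proximal piece `∂_η Γ`: the points `ω ∈ ΔΓ` such that, for every `h ∈ Γ`,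
`(gh)·η - g·η → 0` in the weak-* topology as `g → ω`. -/
def CompactAction.proximalPiece (A : CompactAction.{u, w} Γ) : Set (Ultrafilter Γ) :=
  {ω | ∀ (h : Γ) (f : C(A.space, ℂ)),
    Tendsto (fun g : Γ => (∫ x, f x ∂(A.η.map (fun y => (g * h) • y))) -
      ∫ x, f x ∂(A.η.map (fun y => g • y))) (ω : Filter Γ) (𝓝 0)}

variable (Γ) in
/-- Proper proximality: there is a finite (nonempty) family of continuous actions on compact
spaces without invariant probability measure, with probability measures `η_i`, such that the
sets `∂_{η_i} Γ` have union `∂Γ`. -/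
def ProperlyProximal : Prop :=
  ∃ (k : ℕ) (A : Fin k → CompactAction.{u, w} Γ), 0 < k ∧
    (∀ i, ¬ (A i).HasInvariantProbability) ∧
    ⋃ i, (A i).proximalPiece = stoneCechBoundary Γ

namespace BoundaryPiece

/-- `X` is covered by finitely many proximal pieces coming from actions without invariant
probability measure. -/
def CoveredByProximal (X : BoundaryPiece Γ) : Prop :=
  ∃ (k : ℕ) (A : Fin k → CompactAction.{u, w} Γ),
    (∀ i, ¬ (A i).HasInvariantProbability) ∧ X.carrier ⊆ ⋃ i, (A i).proximalPiece

/-- `X` is equal to a proximal piece coming from an action without invariant probability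
measure. -/
def EqProximal (X : BoundaryPiece Γ) : Prop :=
  ∃ A : CompactAction.{u, w} Γ, ¬ A.HasInvariantProbability ∧ X.carrier = A.proximalPiece

end BoundaryPiece

end Proximal

/-! ## States -/

/-- A state on a unital *-algebra: a linear functional `φ` with `φ(a* a) ≥ 0` for all `a` and
`φ(1) = 1`. -/
structure IsState {A : Type*} [AddCommMonoid A] [Module ℂ A] [Mul A] [Star A] [One A]
    (φ : A →ₗ[ℂ] ℂ) : Prop where
  nonneg : ∀ a : A, 0 ≤ φ (star a * a)
  map_one : φ 1 = 1

/-! ## The bidual of a C*-algebra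

The bidual `A**` is the Banach space bidual. Its C*-algebra structure is given by the Arens
product, the unit `1 ∈ A ⊆ A**`, and the involution `m*(φ) = conj (m (φ*))`, where
`φ*(a) = conj (φ (a*))`. -/

section Bidual

/-- The bidual `A**`. -/
abbrev Bidual (A : Type*) [NormedRing A] [NormedAlgebra ℂ A] : Type _ :=
  StrongDual ℂ (StrongDual ℂ A)

variable {A : Type*} [NormedRing A] [NormedAlgebra ℂ A]

namespace Bidual

/-- For `n ∈ A**`, the operator `φ ↦ n·φ` on `A*`, where `(n·φ)(a) = n (b ↦ φ (a b))`. -/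
def actDual (n : Bidual A) : StrongDual ℂ A →L[ℂ] StrongDual ℂ A :=
  (ContinuousLinearMap.compL ℂ A (StrongDual ℂ A) ℂ n).comp
    (((ContinuousLinearMap.compL ℂ A (A →L[ℂ] A) (StrongDual ℂ A)).flip
      (ContinuousLinearMap.mul ℂ A)).comp (ContinuousLinearMap.compL ℂ A A ℂ))

theorem actDual_apply (n : Bidual A) (φ : StrongDual ℂ A) (a : A) :
    actDual n φ a = n (φ.comp (ContinuousLinearMap.mul ℂ A a)) := rfl

/-- The Arens product on `A**`: `(m n)(φ) = m (n·φ) = m (a ↦ n (b ↦ φ (a b)))`. -/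
def arensMul (m n : Bidual A) : Bidual A := m.comp (actDual n)

/-- The Arens product extends the product of `A`. -/
theorem arensMul_inclusion (a b : A) :
    arensMul (NormedSpace.inclusionInDoubleDual ℂ A a)
      (NormedSpace.inclusionInDoubleDual ℂ A b) =
    NormedSpace.inclusionInDoubleDual ℂ A (a * b) := rfl

/-- The second transpose `T** : A** → A**` of a bounded operator `T` on `A`. -/
def secondTranspose (T : A →L[ℂ] A) (m : Bidual A) : Bidual A := m.comp (T.precomp ℂ)

theorem secondTranspose_apply (T : A →L[ℂ] A) (m : Bidual A) (φ : StrongDual ℂ A) :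
    secondTranspose T m φ = m (φ.comp T) := rfl

theorem secondTranspose_arensMul (T : A →L[ℂ] A) (hT : ∀ a b, T (a * b) = T a * T b)
    (m n : Bidual A) :
    secondTranspose T (arensMul m n) = arensMul (secondTranspose T m) (secondTranspose T n) := by
  ext φ
  refine congrArg m (ContinuousLinearMap.ext fun a => congrArg n ?_)
  ext b
  exact congrArg φ (hT a b)

variable [StarRing A] [NormedStarGroup A] [StarModule ℂ A]

/-- The functional `φ*(a) = conj (φ (a*))`. -/
def dualStar (φ : StrongDual ℂ A) : StrongDual ℂ A :=
  LinearMap.mkContinuous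
    { toFun := fun a => star (φ (star a))
      map_add' := fun a b => by simp
      map_smul' := fun c a => by simp [star_smul] } ‖φ‖
    (fun a => by simpa using φ.le_opNorm (star a))

@[simp]
theorem dualStar_apply (φ : StrongDual ℂ A) (a : A) : dualStar φ a = star (φ (star a)) := rfl

theorem norm_dualStar_le (φ : StrongDual ℂ A) : ‖dualStar φ‖ ≤ ‖φ‖ :=
  LinearMap.mkContinuous_norm_le _ (norm_nonneg φ) _

/-- The involution of `A**`: `m*(φ) = conj (m (φ*))`. -/
def bidualStar (m : Bidual A) : Bidual A :=
  LinearMap.mkContinuous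
    { toFun := fun φ => star (m (dualStar φ))
      map_add' := fun φ ψ => by
        have h : dualStar (φ + ψ) = dualStar φ + dualStar ψ := by ext a; simp
        rw [h, map_add, star_add]
      map_smul' := fun c φ => by
        have h : dualStar (c • φ) = star c • dualStar φ := by ext a; simp
        rw [h, map_smul, star_smul, star_star]; rfl } ‖m‖
    (fun φ => by
      simpa using (m.le_opNorm (dualStar φ)).trans
        (mul_le_mul_of_nonneg_left (norm_dualStar_le φ) (norm_nonneg m)))

theorem bidualStar_apply (m : Bidual A) (φ : StrongDual ℂ A) :
    bidualStar m φ = star (m (dualStar φ)) := rfl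

/-- The involution of `A**` extends that of `A`. -/
theorem bidualStar_inclusion (a : A) :
    bidualStar (NormedSpace.inclusionInDoubleDual ℂ A a) =
      NormedSpace.inclusionInDoubleDual ℂ A (star a) := by
  ext φ
  simp [bidualStar_apply]

theorem secondTranspose_bidualStar (T : A →L[ℂ] A) (hT : ∀ a, T (star a) = star (T a))
    (m : Bidual A) : secondTranspose T (bidualStar m) = bidualStar (secondTranspose T m) := by
  ext φ
  have h : dualStar (φ.comp T) = (dualStar φ).comp T := by
    ext a
    simp [hT]
  rw [secondTranspose_apply, bidualStar_apply, bidualStar_apply, secondTranspose_apply, h]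

end Bidual

end Bidual

/-! ## Translation actions on `C(X)` and on `C(X)**` -/

namespace BoundaryPiece

variable {Γ : Type u} [Group Γ] (X : BoundaryPiece Γ)

instance : CompactSpace X.carrier := isCompact_iff_compactSpace.1 X.isClosed'.isCompact

/-- The left translation `ω ↦ g ω` of `X`. -/
def leftMap (g : Γ) : C(X.carrier, X.carrier) where
  toFun ω := ⟨leftTranslate g ω, X.left_mem g ω ω.2⟩
  continuous_toFun :=
    ((continuous_ultrafilter_map _).comp continuous_subtype_val).subtype_mk _

/-- The right translation `ω ↦ ω g` of `X`. -/
def rightMap (g : Γ) : C(X.carrier, X.carrier) where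
  toFun ω := ⟨rightTranslate g ω, X.right_mem g ω ω.2⟩
  continuous_toFun :=
    ((continuous_ultrafilter_map _).comp continuous_subtype_val).subtype_mk _

/-- The left action `(λ_g f)(ω) = f (g⁻¹ ω)` on `C(X)`. -/
def leftAct (g : Γ) : C(X.carrier, ℂ) →L[ℂ] C(X.carrier, ℂ) where
  toFun f := f.comp (X.leftMap g⁻¹)
  map_add' _ _ := rfl
  map_smul' _ _ := rfl
  cont := ContinuousMap.continuous_precomp _

/-- The right action `(ρ_g f)(ω) = f (ω g)` on `C(X)`. -/
def rightAct (g : Γ) : C(X.carrier, ℂ) →L[ℂ] C(X.carrier, ℂ) where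
  toFun f := f.comp (X.rightMap g)
  map_add' _ _ := rfl
  map_smul' _ _ := rfl
  cont := ContinuousMap.continuous_precomp _

theorem leftMap_rightMap (g h : Γ) (ω : X.carrier) :
    X.leftMap g (X.rightMap h ω) = X.rightMap h (X.leftMap g ω) := by
  apply Subtype.ext
  change Ultrafilter.map _ (Ultrafilter.map _ ω.1) = Ultrafilter.map _ (Ultrafilter.map _ ω.1)
  rw [Ultrafilter.map_map, Ultrafilter.map_map]
  congr 1
  funext x
  exact (mul_assoc g x h).symm

theorem leftAct_rightAct (g h : Γ) (f : C(X.carrier, ℂ)) :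
    X.leftAct g (X.rightAct h f) = X.rightAct h (X.leftAct g f) := by
  ext ω
  exact congrArg f (X.leftMap_rightMap g⁻¹ h ω).symm

/-- The C*-algebra `C(X)^{Γ_r}` of right-`Γ`-invariant continuous functions on `X`. -/
def rightInvariant : StarSubalgebra ℂ C(X.carrier, ℂ) where
  carrier := {f | ∀ h : Γ, X.rightAct h f = f}
  mul_mem' {f₁ f₂} hf₁ hf₂ h := by
    change X.rightAct h f₁ * X.rightAct h f₂ = _
    rw [hf₁ h, hf₂ h]
  add_mem' {f₁ f₂} hf₁ hf₂ h := by rw [map_add, hf₁ h, hf₂ h]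
  algebraMap_mem' _ _ := rfl
  star_mem' {f} hf h := by
    change star (X.rightAct h f) = _
    rw [hf h]

/-- The left action of `Γ` on `C(X)^{Γ_r}`. -/
def leftActInvariant (g : Γ) (f : X.rightInvariant) : X.rightInvariant :=
  ⟨X.leftAct g f, fun h => by rw [← leftAct_rightAct, f.2 h]⟩

/-- There is a left-`Γ`-invariant state on `C(X)^{Γ_r}`. -/
def HasInvariantState : Prop :=
  ∃ φ : X.rightInvariant →ₗ[ℂ] ℂ, IsState φ ∧
    ∀ (g : Γ) (f : X.rightInvariant), φ (X.leftActInvariant g f) = φ f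

/-- The space `(C(X)**)^{Γ_r}` of elements of `C(X)**` fixed by all the `ρ_h**`. -/
def bidualRightInvariant : Submodule ℂ (Bidual C(X.carrier, ℂ)) where
  carrier := {m | ∀ h : Γ, Bidual.secondTranspose (X.rightAct h) m = m}
  add_mem' {m n} hm hn h := by
    change Bidual.secondTranspose (X.rightAct h) m + Bidual.secondTranspose (X.rightAct h) n = _
    rw [hm h, hn h]
  zero_mem' _ := rfl
  smul_mem' c m hm h := by
    change c • Bidual.secondTranspose (X.rightAct h) m = _
    rw [hm h]

/-- The Arens product on `(C(X)**)^{Γ_r}`. -/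
instance : Mul X.bidualRightInvariant :=
  ⟨fun m n => ⟨Bidual.arensMul m.1 n.1, fun h => by
    rw [Bidual.secondTranspose_arensMul _ (fun _ _ => rfl), m.2 h, n.2 h]⟩⟩

/-- The involution of `(C(X)**)^{Γ_r}`. -/
instance : Star X.bidualRightInvariant :=
  ⟨fun m => ⟨Bidual.bidualStar m.1, fun h => by
    rw [Bidual.secondTranspose_bidualStar _ (fun _ => rfl), m.2 h]⟩⟩

/-- The unit of `(C(X)**)^{Γ_r}`. -/
instance : One X.bidualRightInvariant :=
  ⟨⟨NormedSpace.inclusionInDoubleDual ℂ C(X.carrier, ℂ) 1, fun _ => rfl⟩⟩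

/-- The left action of `Γ` on `(C(X)**)^{Γ_r}`, by the operators `λ_g**`. -/
def leftActBidualInvariant (g : Γ) (m : X.bidualRightInvariant) : X.bidualRightInvariant :=
  ⟨Bidual.secondTranspose (X.leftAct g) m.1, fun h => by
    ext φ
    rw [Bidual.secondTranspose_apply, Bidual.secondTranspose_apply,
      Bidual.secondTranspose_apply]
    have hc : (φ.comp (X.rightAct h)).comp (X.leftAct g) =
        (φ.comp (X.leftAct g)).comp (X.rightAct h) := by
      ext f
      exact congrArg φ (X.leftAct_rightAct g h f).symm
    rw [hc]
    exact congrArg (fun k : Bidual C(X.carrier, ℂ) => k (φ.comp (X.leftAct g))) (m.2 h)⟩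

/-- There is a left-`Γ`-invariant state on `(C(X)**)^{Γ_r}`. -/
def HasInvariantStateBidual : Prop :=
  ∃ φ : X.bidualRightInvariant →ₗ[ℂ] ℂ, IsState φ ∧
    ∀ (g : Γ) (m : X.bidualRightInvariant), φ (X.leftActBidualInvariant g m) = φ m

end BoundaryPiece

end

/-! The implications form the cycle (iii) ⇒ (ii) ⇒ (i) ⇒ (iv) ⇒ (iii); only (ii) ⇒ (i) is immediate.

(iii) ⇒ (ii): the functions on `ΔΓ` whose restriction to `X` is right-invariant form a
left-invariant C*-algebra, whose spectrum `Factor X` carries the point mass at the identity. The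
orbit of this point mass converges along `ω` to the point mass at the class of `ω`, so its proximal
piece consists of the `ω` with the same class as all `ωh`. Points of `X` qualify by construction.
Points off `X` are alone in their class and are moved by every `h ≠ 1`, so they do not
(`proximalPiece_factorAction`). An invariant measure on `Factor X` would give an invariant state:
functions in `C(X)^{Γ_r}` extend equivariantly to bounded Borel functions on `Factor X`, using
limits along one orbit in `X` for the points off `X` (`hasInvariantState_of_factorAction`).

(i) ⇒ (iv): the sets `Y_i = X ∩ ∂_{η_i}Γ` are closed and bi-invariant, so their indicators are
elements of `C(X)**`. Let `φ` be an invariant state. As the `Y_i` cover `X`, some `φ(1_{Y_i})` is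
nonzero. The Poisson transform `P` of `(K_i, η_i)` is right-invariant on `Y_i`, so `f ↦ φ(1_{Y_i} P
f)` normalizes to an invariant probability measure on `K_i`
(`not_hasInvariantStateBidual_of_covered`).

(iv) ⇒ (iii): without an invariant state on `(C(X)**)^{Γ_r}`, Hahn–Banach produces a coboundary `∑
(m_j - g_j m_j)` with real part at least `c > 0`. A second separation replaces the `m_j` by
uniformly bounded functions in `C(X)` that are only nearly right-invariant
(`exists_approx_of_bidual`). These lift to a sequence of functions on `Γ`, and averaging the first
`l(x)` of them at `x`, for a slowly varying `l` tending to infinity at `X`, makes them exactly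
right-invariant on `X` while keeping a lower bound `c/2` (`exists_invariant_of_approx`). An
invariant state on `C(X)^{Γ_r}` would send this coboundary to `0`. -/

noncomputable section

open MeasureTheory Filter Topology
open scoped ComplexOrder

/-! ### Positive functionals on `C(K)` and their representing measures -/

section PositiveFunctionals

variable {K : Type*} [TopologicalSpace K]

/-- A real continuous function, viewed as a complex one. -/
def ContinuousMap.toComplex (f : C(K, ℝ)) : C(K, ℂ) :=
  ⟨fun x => (f x : ℂ), Complex.continuous_ofReal.comp f.continuous⟩

@[simp]
theorem ContinuousMap.toComplex_apply (f : C(K, ℝ)) (x : K) : f.toComplex x = (f x : ℂ) := rfl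

/-- The real part of a complex continuous function. -/
def ContinuousMap.rePart (f : C(K, ℂ)) : C(K, ℝ) :=
  ⟨fun x => (f x).re, Complex.continuous_re.comp f.continuous⟩

/-- The imaginary part of a complex continuous function. -/
def ContinuousMap.imPart (f : C(K, ℂ)) : C(K, ℝ) :=
  ⟨fun x => (f x).im, Complex.continuous_im.comp f.continuous⟩

theorem ContinuousMap.rePart_add_imPart (f : C(K, ℂ)) :
    f = f.rePart.toComplex + Complex.I • f.imPart.toComplex := by
  ext x
  simp [ContinuousMap.rePart, ContinuousMap.imPart, mul_comm Complex.I, Complex.re_add_im]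

/-- The second clause lets the square root inherit every invariance of `b`, so that positive
elements of invariant subalgebras are squares there. -/
theorem ContinuousMap.exists_star_mul_self (b : C(K, ℂ)) (hb : ∀ x, 0 ≤ b x) :
    ∃ s : C(K, ℂ), star s * s = b ∧ ∀ x y, b x = b y → s x = s y := by
  refine ⟨ContinuousMap.toComplex
    ⟨fun x => Real.sqrt (b x).re, (Complex.continuous_re.comp b.continuous).sqrt⟩, ?_, ?_⟩
  · ext x
    have h1 := Complex.le_def.1 (hb x)
    have h2 : b x = ((b x).re : ℂ) := Complex.ext rfl (by simpa using h1.2.symm)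
    change star ((Real.sqrt (b x).re : ℝ) : ℂ) * ((Real.sqrt (b x).re : ℝ) : ℂ) = b x
    rw [Complex.star_def, Complex.conj_ofReal, ← Complex.ofReal_mul, Real.mul_self_sqrt h1.1,
      ← h2]
  · intro x y h
    change ((Real.sqrt (b x).re : ℝ) : ℂ) = ((Real.sqrt (b y).re : ℝ) : ℂ)
    rw [h]

/-- A linear functional on `C(K)` which is nonnegative on nonnegative functions. -/
def IsPositiveFunctional (ν : C(K, ℂ) →ₗ[ℂ] ℂ) : Prop :=
  ∀ u : C(K, ℂ), (∀ x, 0 ≤ u x) → 0 ≤ ν u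

theorem IsPositiveFunctional.im_toComplex [CompactSpace K] {ν : C(K, ℂ) →ₗ[ℂ] ℂ}
    (hν : IsPositiveFunctional ν) (f : C(K, ℝ)) : (ν f.toComplex).im = 0 := by
  have h1 : f.toComplex = (f + ContinuousMap.const K ‖f‖).toComplex -
      (ContinuousMap.const K ‖f‖).toComplex := by
    ext x; simp
  have h2 := hν (f + ContinuousMap.const K ‖f‖).toComplex fun x => by
    have := (abs_le.1 (f.norm_coe_le_norm x)).1
    have h : 0 ≤ f x + ‖f‖ := by linarith
    simpa using (Complex.zero_le_real.2 h)
  have h3 := hν (ContinuousMap.const K ‖f‖).toComplex fun x => by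
    simp
  rw [h1, map_sub, Complex.sub_im, ← (Complex.le_def.1 h2).2, ← (Complex.le_def.1 h3).2]
  simp

theorem IsPositiveFunctional.exists_measure [CompactSpace K] [T2Space K] [MeasurableSpace K]
    [BorelSpace K] {ν : C(K, ℂ) →ₗ[ℂ] ℂ} (hν : IsPositiveFunctional ν) :
    ∃ μ : Measure K, IsFiniteMeasure μ ∧ μ.Regular ∧ ∀ f : C(K, ℂ), ν f = ∫ x, f x ∂μ := by
  let Λ : CompactlySupportedContinuousMap K ℝ →ₚ[ℝ] ℝ :=
    { toFun := fun f => (ν f.toContinuousMap.toComplex).re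
      map_add' := fun f g => by
        rw [← Complex.add_re, ← map_add]
        congr 2
        ext x; simp
      map_smul' := fun c f => by
        have : (c • f).toContinuousMap.toComplex = (c : ℂ) • f.toContinuousMap.toComplex := by
          ext x; simp
        rw [this, map_smul]
        simp
      monotone' := fun f g hfg => by
        have h := hν (g.toContinuousMap.toComplex - f.toContinuousMap.toComplex) fun x => by
          have := hfg x
          simpa using this
        rw [map_sub] at h
        have := (Complex.le_def.1 h).1
        simp only [Complex.zero_re, Complex.sub_re] at this
        change (ν f.toContinuousMap.toComplex).re ≤ (ν g.toContinuousMap.toComplex).re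
        linarith }
  refine ⟨RealRMK.rieszMeasure Λ, inferInstance, inferInstance, fun f => ?_⟩
  have key : ∀ f : C(K, ℝ), ν f.toComplex = ∫ x, f.toComplex x ∂(RealRMK.rieszMeasure Λ) := by
    intro f
    have h := RealRMK.integral_rieszMeasure Λ ⟨f, HasCompactSupport.of_compactSpace f⟩
    have h' : ∫ x, f x ∂(RealRMK.rieszMeasure Λ) = (ν f.toComplex).re := h
    simp only [ContinuousMap.toComplex_apply]
    rw [integral_complex_ofReal, h']
    exact Complex.ext (by simp) (by simp [hν.im_toComplex f])
  have hint : ∀ g : C(K, ℂ), Integrable g (RealRMK.rieszMeasure Λ) := fun g =>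
    BoundedContinuousFunction.integrable _ (BoundedContinuousFunction.mkOfCompact g)
  conv_lhs => rw [f.rePart_add_imPart]
  conv_rhs => rw [f.rePart_add_imPart]
  rw [map_add, map_smul, key, key]
  simp only [ContinuousMap.add_apply, ContinuousMap.smul_apply]
  rw [← integral_smul]
  exact (integral_add (hint _) ((hint _).smul Complex.I)).symm

theorem IsPositiveFunctional.norm_apply_le [CompactSpace K] [T2Space K]
    {ν : C(K, ℂ) →ₗ[ℂ] ℂ} (hν : IsPositiveFunctional ν) (f : C(K, ℂ)) :
    ‖ν f‖ ≤ (ν 1).re * ‖f‖ := by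
  borelize K
  obtain ⟨μ, hμ, -, h⟩ := hν.exists_measure
  have h1 : ν 1 = (μ.real Set.univ : ℂ) := by
    rw [h]
    simp
  rw [h1, Complex.ofReal_re, h, mul_comm]
  exact norm_integral_le_of_norm_le_const (ae_of_all _ f.norm_coe_le_norm)

end PositiveFunctionals

/-! ### Positivity of `m* m` for the Arens product -/

section Arens

variable {K : Type*} [TopologicalSpace K] [CompactSpace K]

/-- A GNS argument: on functionals of the form `a ↦ ⟨ι(a*), ξ⟩` the element `m` is bounded in `ξ`,
hence given by a vector `ζ`, and then `(m* m)(ν) = ‖ζ‖²`. Commutativity of `C(K)` identifies `b ↦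
ν(ab)` with the functional attached to `ι a`. -/
theorem Bidual.arensMul_star_self_nonneg_of_inner {H : Type*} [NormedAddCommGroup H]
    [InnerProductSpace ℂ H] [CompleteSpace H] (ι : C(K, ℂ) →L[ℂ] H) (ν : StrongDual ℂ C(K, ℂ))
    (hν : ∀ a b : C(K, ℂ), ν (a * b) = inner ℂ (ι (star a)) (ι b)) (m : Bidual C(K, ℂ)) :
    0 ≤ Bidual.arensMul (Bidual.bidualStar m) m ν := by
  let k : H →L[ℂ] StrongDual ℂ C(K, ℂ) :=
    LinearMap.mkContinuous₂
      { toFun := fun ξ =>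
          { toFun := fun a => inner ℂ (ι (star a)) ξ
            map_add' := fun a b => by simp
            map_smul' := fun c a => by simp [star_smul, mul_comm] }
        map_add' := fun ξ ζ => by ext a; simp
        map_smul' := fun c ξ => by ext a; simp } ‖ι‖
      (fun ξ a => by
        refine (norm_inner_le_norm _ _).trans ?_
        have := ι.le_opNorm (star a)
        rw [norm_star] at this
        calc ‖ι (star a)‖ * ‖ξ‖ ≤ ‖ι‖ * ‖a‖ * ‖ξ‖ := by gcongr
          _ = _ := by ring)
  have hk : ∀ ξ a, k ξ a = inner ℂ (ι (star a)) ξ := fun _ _ => rfl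
  obtain ⟨ζ, hζ⟩ := (InnerProductSpace.toDual ℂ H).surjective (m.comp k)
  have hm : ∀ ξ, m (k ξ) = inner ℂ ζ ξ := fun ξ => by
    have := DFunLike.congr_fun hζ ξ
    simpa using this.symm
  have h1 : ∀ a, Bidual.actDual m ν a = inner ℂ ζ (ι a) := fun a => by
    rw [Bidual.actDual_apply, ← hm]
    congr 1
    ext b
    rw [hk, ← hν]
    change ν (a * b) = ν (b * a)
    rw [mul_comm]
  have h2 : Bidual.dualStar (Bidual.actDual m ν) = k ζ := by
    ext a
    rw [Bidual.dualStar_apply, h1, hk]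
    exact inner_conj_symm _ _
  change 0 ≤ Bidual.bidualStar m (Bidual.actDual m ν)
  rw [Bidual.bidualStar_apply, h2, hm]
  rw [star_nonneg_iff]
  rw [inner_self_eq_norm_sq_to_K]
  positivity

theorem Bidual.arensMul_star_self_nonneg [T2Space K] (ν : StrongDual ℂ C(K, ℂ))
    (hν : IsPositiveFunctional ν.toLinearMap) (m : Bidual C(K, ℂ)) :
    0 ≤ Bidual.arensMul (Bidual.bidualStar m) m ν := by
  borelize K
  obtain ⟨μ, hμ, -, h⟩ := hν.exists_measure
  refine arensMul_star_self_nonneg_of_inner (ContinuousMap.toLp 2 μ ℂ) ν (fun a b => ?_) m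
  rw [ContinuousMap.inner_toLp]
  refine (h (a * b)).trans ?_
  refine integral_congr_ae (ae_of_all _ fun x => ?_)
  simp [mul_comm]

end Arens

/-! ### From the bidual back to `C(K)` by separation -/

section Approximation

theorem StrongDual.exists_re_apply_ge {E : Type*} [NormedAddCommGroup E] [NormedSpace ℂ E]
    (ψ : StrongDual ℂ E) {M δ : ℝ} (hM : 0 ≤ M) (hδ : 0 < δ) :
    ∃ f : E, ‖f‖ ≤ M ∧ M * ‖ψ‖ - δ ≤ (ψ f).re := by
  obtain rfl | hM' := hM.eq_or_lt
  · exact ⟨0, by simp, by simp; linarith⟩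
  by_cases hψ : ‖ψ‖ - δ / M < 0
  · refine ⟨0, by simpa using hM, ?_⟩
    have : M * (‖ψ‖ - δ / M) ≤ 0 := mul_nonpos_of_nonneg_of_nonpos hM hψ.le
    rw [mul_sub, mul_div_cancel₀ _ hM'.ne'] at this
    simpa using this
  push Not at hψ
  obtain ⟨x, hx, hlt⟩ := ψ.exists_lt_apply_of_lt_opNorm (r := ‖ψ‖ - δ / M)
    (sub_lt_self _ (by positivity))
  have hz : ψ x ≠ 0 := by
    intro h
    rw [h, norm_zero] at hlt
    linarith
  have hn : (‖ψ x‖ : ℂ) ≠ 0 := by simpa using hz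
  -- The phase of `ψ x` is cancelled, so that the value becomes the real number `M * ‖ψ x‖`.
  refine ⟨((M : ℂ) * (star (ψ x) / (‖ψ x‖ : ℂ))) • x, ?_, ?_⟩
  · rw [norm_smul, norm_mul, norm_div, norm_star]
    simp only [Complex.norm_real, norm_norm, Real.norm_of_nonneg hM]
    rw [div_self (norm_ne_zero_iff.2 hz)]
    nlinarith
  · have : ψ (((M : ℂ) * (star (ψ x) / (‖ψ x‖ : ℂ))) • x) = ((M * ‖ψ x‖ : ℝ) : ℂ) := by
      rw [map_smul, smul_eq_mul]
      have h2 : star (ψ x) * ψ x = (‖ψ x‖ : ℂ) ^ 2 := Complex.conj_mul' _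
      push_cast
      calc (M : ℂ) * (star (ψ x) / ‖ψ x‖) * ψ x = M * (star (ψ x) * ψ x) / ‖ψ x‖ := by ring
        _ = _ := by rw [h2]; field_simp
    rw [this, Complex.ofReal_re]
    have := mul_le_mul_of_nonneg_left hlt.le hM
    rw [mul_sub, mul_div_cancel₀ _ hM'.ne'] at this
    exact this

variable {K : Type*} [TopologicalSpace K]

/-- Applied to `u` and to `±i u`, the hypothesis forces `ν u` to be real when `u ≥ 0`. -/
theorem isPositiveFunctional_of_re {ν : C(K, ℂ) →ₗ[ℂ] ℂ}
    (h : ∀ u : C(K, ℂ), (∀ x, 0 ≤ (u x).re) → 0 ≤ (ν u).re) : IsPositiveFunctional ν := by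
  intro u hu
  refine Complex.le_def.2 ⟨h u fun x => (Complex.le_def.1 (hu x)).1, ?_⟩
  have him : ∀ x, (u x).im = 0 := fun x => (Complex.le_def.1 (hu x)).2.symm
  have h1 := h (Complex.I • u) fun x => by simp [him]
  have h2 := h (-(Complex.I • u)) fun x => by simp [him]
  rw [map_neg, map_smul] at h2
  rw [map_smul] at h1
  simp at h1 h2 ⊢
  linarith

/-- Goldstine's theorem and the passage from weak to norm approximation in one separation. If no
tuple in the `M`-balls works, a functional with components `ν` and `ξ` separates. Pairing the `m i`
with its pullback `ψ i` kills the `ξ`-part because the `m i` are fixed by the `R h`, and what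
remains contradicts the lower bound `hm`. -/
theorem exists_approx_of_bidual [CompactSpace K] {ι κ : Type*} [Fintype ι] [Fintype κ] [DecidableEq ι]
    [DecidableEq κ] (L : ι → C(K, ℂ) →L[ℂ] C(K, ℂ)) (R : κ → C(K, ℂ) →L[ℂ] C(K, ℂ))
    (m : ι → Bidual C(K, ℂ)) (hR : ∀ i h, Bidual.secondTranspose (R h) (m i) = m i) {c : ℝ}
    (hm : ∀ ν : StrongDual ℂ C(K, ℂ), IsPositiveFunctional ν.toLinearMap →
      c * (ν 1).re ≤ (∑ i, (m i ν - Bidual.secondTranspose (L i) (m i) ν)).re)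
    {M : ℝ} (hM0 : 0 ≤ M) (hM : ∀ i, ‖m i‖ ≤ M) {ε : ℝ} (hε : 0 < ε) :
    ∃ f : ι → C(K, ℂ), (∀ i, ‖f i‖ ≤ M) ∧ (∀ x, c - ε < (∑ i, (f i x - L i (f i) x)).re) ∧
      ∀ i h, ‖f i - R h (f i)‖ < ε := by
  -- The components are the coboundary of a tuple and its defects of right-invariance.
  let Θ : (ι → C(K, ℂ)) →ₗ[ℂ] C(K, ℂ) × (ι × κ → C(K, ℂ)) :=
    (∑ i, (LinearMap.id - (L i).toLinearMap) ∘ₗ LinearMap.proj i).prod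
      (LinearMap.pi fun p => (LinearMap.id - (R p.2).toLinearMap) ∘ₗ LinearMap.proj p.1)
  have hΘ1 : ∀ f, (Θ f).1 = ∑ i, (f i - L i (f i)) := fun f => by simp [Θ]
  have hΘ2 : ∀ f p, (Θ f).2 p = f p.1 - R p.2 (f p.1) := fun f p => rfl
  let s : Set (C(K, ℂ) × (ι × κ → C(K, ℂ))) := {u : C(K, ℂ) | ∀ x, c - ε < (u x).re} ×ˢ Metric.ball 0 ε
  let t : Set (C(K, ℂ) × (ι × κ → C(K, ℂ))) := Θ '' (Set.univ.pi fun _ => Metric.closedBall 0 M)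
  by_contra hcon
  have hdisj : Disjoint s t := by
    rw [Set.disjoint_right]
    rintro _ ⟨f, hf, rfl⟩ ⟨h1, h2⟩
    refine hcon ⟨f, fun i => by simpa using hf i trivial, fun x => ?_, fun i h => ?_⟩
    · have := h1 x
      rw [hΘ1] at this
      simpa using this
    · have h3 : ‖(Θ f).2‖ < ε := by simpa using h2
      exact (norm_le_pi_norm (Θ f).2 (i, h)).trans_lt h3
  have hs1 : Convex ℝ s := by
    refine Convex.prod (fun u hu v hv a b ha hb hab x => ?_) (convex_ball _ _)
    have h1 := hu x
    have h2 := hv x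
    simp only [ContinuousMap.add_apply, ContinuousMap.smul_apply, Complex.add_re, Complex.real_smul,
      Complex.mul_re, Complex.ofReal_re, Complex.ofReal_im, zero_mul, sub_zero]
    have h3 : a * (c - ε) + b * (c - ε) = c - ε := by rw [← add_mul, hab, one_mul]
    rcases ha.eq_or_lt with rfl | ha
    · have : b = 1 := by linarith
      subst this; linarith
    · nlinarith
  have hs2 : IsOpen s := by
    refine IsOpen.prod ?_ Metric.isOpen_ball
    have := ContinuousMap.isOpen_setOfPred_mapsTo (X := K) (Y := ℂ) isCompact_univ
      (isOpen_lt (continuous_const (y := c - ε)) Complex.continuous_re)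
    convert this using 1
    ext u
    simp [Set.MapsTo]
  have ht : Convex ℝ t :=
    (convex_pi fun i _ => convex_closedBall 0 M).linear_image (Θ.restrictScalars ℝ)
  obtain ⟨ℓ, r, hr1, hr2⟩ := RCLike.geometric_hahn_banach_open (𝕜 := ℂ) hs1 hs2 ht hdisj
  let ν : StrongDual ℂ C(K, ℂ) := -(ℓ.comp (ContinuousLinearMap.inl ℂ _ _))
  let ξ : ι × κ → StrongDual ℂ C(K, ℂ) := fun p =>
    -(ℓ.comp ((ContinuousLinearMap.inr ℂ _ _).comp
      (ContinuousLinearMap.single ℂ (fun _ : ι × κ => C(K, ℂ)) p)))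
  have hℓ : ∀ y : C(K, ℂ) × (ι × κ → C(K, ℂ)), -ℓ y = ν y.1 + ∑ p, ξ p (y.2 p) := by
    intro y
    have h1 : y = (y.1, 0) + (0, ∑ p, Pi.single p (y.2 p)) := by
      rw [Finset.univ_sum_single]; simp
    have h2 : ((0, ∑ p, Pi.single p (y.2 p)) : C(K, ℂ) × (ι × κ → C(K, ℂ))) = ∑ p, (0, Pi.single p (y.2 p)) :=
      map_sum (AddMonoidHom.inr C(K, ℂ) (ι × κ → C(K, ℂ))) _ _
    conv_lhs => rw [h1, h2]
    rw [map_add, map_sum, neg_add, ← Finset.sum_neg_distrib]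
    rfl
  have hν1 : ∀ u : C(K, ℂ), (∀ x, c - ε < (u x).re) → -r < (ν u).re := by
    intro u hu
    have h1 := hr1 (u, 0) ⟨hu, by simpa using hε⟩
    have h2 := congrArg Complex.re (hℓ (u, 0))
    have h3 : ∑ p, ξ p ((0 : ι × κ → C(K, ℂ)) p) = 0 := by simp
    rw [h3, add_zero] at h2
    rw [← h2, Complex.neg_re]
    exact neg_lt_neg h1
  have hconst : ∀ a : ℝ, (ν ((a : ℂ) • (1 : C(K, ℂ)))).re = a * (ν 1).re := by
    intro a
    rw [map_smul]
    simp
  -- The first factor of `s` is stable under adding functions with nonnegative real part. A negative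
  -- value of `ν` on such a `u` would, after scaling, violate the lower bound `-r`.
  have hpos : IsPositiveFunctional ν.toLinearMap := by
    refine isPositiveFunctional_of_re fun u hu => ?_
    by_contra hneg
    push Not at hneg
    change (ν u).re < 0 at hneg
    obtain ⟨n, hn⟩ := exists_nat_gt ((c * (ν 1).re + r) / -(ν u).re)
    rw [div_lt_iff₀ (by linarith)] at hn
    have h1 := hν1 ((c : ℂ) • 1 + ((n : ℝ) : ℂ) • u) fun x => by
      have := mul_nonneg (Nat.cast_nonneg (α := ℝ) n) (hu x)
      simp
      linarith
    rw [map_add, Complex.add_re, hconst, map_smul] at h1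
    simp at h1
    linarith
  let ψ : ι → StrongDual ℂ C(K, ℂ) := fun i =>
    ν - ν.comp (L i) + ∑ h, (ξ (i, h) - (ξ (i, h)).comp (R h))
  have hΘ : ∀ f, -ℓ (Θ f) = ∑ i, ψ i (f i) := by
    intro f
    rw [hℓ]
    simp only [hΘ1, hΘ2, ψ, map_sum, map_sub, add_apply, sub_apply,
      ContinuousLinearMap.comp_apply, sum_apply, Finset.sum_add_distrib, Fintype.sum_prod_type]
  have hmψ : ∀ i, m i (ψ i) = m i ν - Bidual.secondTranspose (L i) (m i) ν := by
    intro i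
    have : ∀ h, m i (ξ (i, h)) = m i ((ξ (i, h)).comp (R h)) := fun h => by
      conv_lhs => rw [← hR i h]
      rfl
    simp only [ψ, map_add, map_sub, map_sum, this, sub_self, Finset.sum_const_zero, add_zero]
    rfl
  have hbound : ∑ i, M * ‖ψ i‖ ≤ -r := by
    refine le_of_forall_pos_le_add fun δ hδ => ?_
    -- The error is shared among the indices; the `+ 1` covers an empty `ι`.
    have hδ' : 0 < δ / (Fintype.card ι + 1) := by positivity
    choose f hf1 hf2 using fun i => (ψ i).exists_re_apply_ge hM0 hδ'
    have h1 := hr2 (Θ f) ⟨f, fun i _ => by simpa using hf1 i, rfl⟩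
    have h2 := congrArg Complex.re (hΘ f)
    rw [Complex.neg_re, Complex.re_sum] at h2
    have h3 := Finset.sum_le_sum fun i (_ : i ∈ Finset.univ) => hf2 i
    rw [Finset.sum_sub_distrib, Finset.sum_const, Finset.card_univ, nsmul_eq_mul] at h3
    have h4 : (Fintype.card ι : ℝ) * (δ / (Fintype.card ι + 1)) ≤ δ := by
      rw [← mul_div_assoc, div_le_iff₀ (by positivity)]
      nlinarith
    change r ≤ (ℓ (Θ f)).re at h1
    linarith
  have h5 := hm ν hpos
  have h6 : (∑ i, (m i ν - Bidual.secondTranspose (L i) (m i) ν)).re ≤ ∑ i, M * ‖ψ i‖ := by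
    rw [Complex.re_sum]
    refine Finset.sum_le_sum fun i _ => ?_
    rw [← hmψ]
    exact (Complex.re_le_norm _).trans (((m i).le_opNorm _).trans
      (mul_le_mul_of_nonneg_right (hM i) (norm_nonneg _)))
  -- Together with `h5`, `h6` and `hbound` this yields `c ν(1) < (c - ε/2) ν(1)`, impossible for
  -- `ν(1) ≥ 0`.
  have h7 := hν1 (((c - ε / 2 : ℝ) : ℂ) • 1) fun x => by
    simp only [ContinuousMap.smul_apply, ContinuousMap.one_apply, smul_eq_mul, mul_one,
      Complex.ofReal_re]
    linarith
  rw [hconst] at h7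
  have h8 : 0 ≤ (ν 1).re := (Complex.le_def.1 (hpos 1 fun x => by simp)).1
  nlinarith

end Approximation

/-! ### Extending bounded functions to ultrafilters, and clopen sets -/

section UltrafilterExtension

variable {α : Type*}

theorem exists_continuousMap_ultrafilter (F : α → ℂ) (hF : ∃ C, ∀ x, ‖F x‖ ≤ C) :
    ∃ G : C(Ultrafilter α, ℂ), ∀ ω : Ultrafilter α, Tendsto F ω (𝓝 (G ω)) := by
  obtain ⟨C, hC⟩ := hF
  let F' : α → Metric.closedBall (0 : ℂ) C := fun x => ⟨F x, by simpa using hC x⟩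
  have : CompactSpace (Metric.closedBall (0 : ℂ) C) :=
    isCompact_iff_compactSpace.1 (isCompact_closedBall 0 C)
  refine ⟨⟨fun ω => ((Ultrafilter.extend F' ω : Metric.closedBall (0 : ℂ) C) : ℂ),
    continuous_subtype_val.comp (continuous_ultrafilter_extend F')⟩, fun ω => ?_⟩
  have h : Tendsto F' ω (𝓝 (Ultrafilter.extend F' ω)) := ultrafilter_extend_eq_iff.1 rfl
  exact (continuous_subtype_val.tendsto _).comp h

open Classical in
/-- The continuous extension to `Ultrafilter α` of a bounded function on `α`. -/
def ultrafilterExtend (F : α → ℂ) : C(Ultrafilter α, ℂ) :=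
  if hF : ∃ C, ∀ x, ‖F x‖ ≤ C then (exists_continuousMap_ultrafilter F hF).choose else 0

theorem tendsto_ultrafilterExtend {F : α → ℂ} {C : ℝ} (hF : ∀ x, ‖F x‖ ≤ C)
    (ω : Ultrafilter α) : Tendsto F ω (𝓝 (ultrafilterExtend F ω)) := by
  have h : ∃ C, ∀ x, ‖F x‖ ≤ C := ⟨C, hF⟩
  rw [ultrafilterExtend, dif_pos h]
  exact (exists_continuousMap_ultrafilter F h).choose_spec ω

theorem tendsto_apply_pure {E : Type*} [TopologicalSpace E] {G : Ultrafilter α → E}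
    (hG : Continuous G) (ω : Ultrafilter α) :
    Tendsto (fun x => G (pure x)) ω (𝓝 (G ω)) :=
  (hG.tendsto ω).comp (Ultrafilter.tendsto_pure_self ω)

/-- The indicator function of a clopen set, as a continuous function. -/
def clopenIndicator {K : Type*} [TopologicalSpace K] (C : TopologicalSpace.Clopens K) : C(K, ℂ) :=
  ⟨Set.indicator (C : Set K) 1, C.isClopen.continuous_indicator continuous_one⟩

theorem clopenIndicator_of_mem {K : Type*} [TopologicalSpace K] {C : TopologicalSpace.Clopens K}
    {x : K} (hx : x ∈ C) : clopenIndicator C x = 1 :=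
  Set.indicator_of_mem (s := (C : Set K)) hx 1

theorem clopenIndicator_of_notMem {K : Type*} [TopologicalSpace K]
    {C : TopologicalSpace.Clopens K} {x : K} (hx : x ∉ C) : clopenIndicator C x = 0 :=
  Set.indicator_of_notMem (s := (C : Set K)) hx 1

/-- The clopen subset of `Ultrafilter α` defined by a subset of `α`. -/
def ultrafilterClopen (S : Set α) : TopologicalSpace.Clopens (Ultrafilter α) :=
  ⟨{ω | S ∈ ω}, ultrafilter_isClosed_basic S, ultrafilter_isOpen_basic S⟩

theorem exists_mem_of_notMem_closed {Y : Set (Ultrafilter α)} (hY : IsClosed Y)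
    {τ : Ultrafilter α} (hτ : τ ∉ Y) : ∃ S ∈ τ, ∀ ω ∈ Y, S ∉ ω := by
  obtain ⟨_, ⟨S, rfl⟩, h1, h2⟩ :=
    ultrafilterBasis_is_basis.mem_nhds_iff.1 (hY.isOpen_compl.mem_nhds hτ)
  exact ⟨S, h1, fun ω hω hS => h2 hS hω⟩

end UltrafilterExtension

/-! ### Translations of ultrafilters -/

section Translations

variable {Γ : Type u} [Group Γ]

theorem leftTranslate_leftTranslate (g h : Γ) (ω : Ultrafilter Γ) :
    leftTranslate g (leftTranslate h ω) = leftTranslate (g * h) ω := by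
  rw [leftTranslate, leftTranslate, leftTranslate, Ultrafilter.map_map]
  congr 1
  funext x
  exact (mul_assoc g h x).symm

theorem rightTranslate_rightTranslate (g h : Γ) (ω : Ultrafilter Γ) :
    rightTranslate g (rightTranslate h ω) = rightTranslate (h * g) ω := by
  rw [rightTranslate, rightTranslate, rightTranslate, Ultrafilter.map_map]
  congr 1
  funext x
  exact mul_assoc x h g

theorem leftTranslate_rightTranslate (g h : Γ) (ω : Ultrafilter Γ) :
    leftTranslate g (rightTranslate h ω) = rightTranslate h (leftTranslate g ω) := by
  rw [leftTranslate, rightTranslate, rightTranslate, leftTranslate, Ultrafilter.map_map,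
    Ultrafilter.map_map]
  congr 1
  funext x
  exact (mul_assoc g x h).symm

@[simp]
theorem leftTranslate_one (ω : Ultrafilter Γ) : leftTranslate 1 ω = ω := by
  simp only [leftTranslate, one_mul]
  exact Ultrafilter.map_id ω

@[simp]
theorem rightTranslate_one (ω : Ultrafilter Γ) : rightTranslate 1 ω = ω := by
  simp only [rightTranslate, mul_one]
  exact Ultrafilter.map_id ω

theorem leftTranslate_pure (g x : Γ) : leftTranslate g (pure x) = pure (g * x) :=
  Ultrafilter.map_pure _ _

theorem rightTranslate_pure (g x : Γ) : rightTranslate g (pure x) = pure (x * g) :=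
  Ultrafilter.map_pure _ _

theorem continuous_leftTranslate (g : Γ) : Continuous (leftTranslate g) :=
  continuous_ultrafilter_map _

theorem continuous_rightTranslate (g : Γ) : Continuous (rightTranslate g) :=
  continuous_ultrafilter_map _

/-- A nontrivial right translation has no fixed ultrafilter. -/
theorem rightTranslate_ne {h : Γ} (hh : h ≠ 1) (ω : Ultrafilter Γ) : rightTranslate h ω ≠ ω := by
  -- A maximal set disjoint from its translate by `h`. By maximality it covers `Γ` together with its
  -- translates by `h` and `h⁻¹`. A fixed ultrafilter contains one of the three sets, hence `A`
  -- itself and the disjoint set of `x` with `x * h ∈ A`.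
  obtain ⟨A, hA⟩ := zorn_subset {A : Set Γ | ∀ x ∈ A, x * h ∉ A} (by
    intro c hc hchain
    refine ⟨⋃₀ c, ?_, fun s hs => Set.subset_sUnion_of_mem hs⟩
    rintro x ⟨s, hs, hxs⟩ ⟨t, ht, hxt⟩
    rcases hchain.total hs ht with hst | hts
    · exact hc ht x (hst hxs) hxt
    · exact hc hs x hxs (hts hxt))
  have hcover : ∀ x, x ∈ A ∨ x * h ∈ A ∨ x * h⁻¹ ∈ A := by
    intro x
    by_contra! hx
    have hins : insert x A ∈ {A : Set Γ | ∀ x ∈ A, x * h ∉ A} := by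
      rintro y (rfl | hy) (hyx | hyA)
      · exact hh (mul_eq_left.1 hyx)
      · exact hx.2.1 hyA
      · exact hx.2.2 (by rw [← hyx]; simpa using hy)
      · exact hA.prop y hy hyA
    exact hx.1 (hA.le_of_ge hins (Set.subset_insert x A) (Set.mem_insert x A))
  intro hω
  have hmem : ∀ S : Set Γ, S ∈ ω ↔ (fun x => x * h) ⁻¹' S ∈ ω := fun S => by
    conv_lhs => rw [← hω]
    exact Ultrafilter.mem_map
  have hdis : A ∉ ω := fun hAω => by
    obtain ⟨x, hx1, hx2⟩ := ω.nonempty_of_mem (inter_mem hAω ((hmem A).1 hAω))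
    exact hA.prop x hx1 hx2
  have hdis' : (fun x => x * h⁻¹) ⁻¹' A ∉ ω := fun h' => by
    refine hdis (mem_of_superset ((hmem _).1 h') fun x hx => ?_)
    simpa using hx
  have huniv : A ∪ ((fun x => x * h) ⁻¹' A ∪ (fun x => x * h⁻¹) ⁻¹' A) ∈ ω :=
    mem_of_superset univ_mem fun x _ => hcover x
  rcases Ultrafilter.union_mem_iff.1 huniv with h1 | h1
  · exact hdis h1
  · rcases Ultrafilter.union_mem_iff.1 h1 with h2 | h2
    · exact hdis ((hmem A).2 h2)
    · exact hdis' h2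

namespace BoundaryPiece

variable (X : BoundaryPiece Γ)

theorem leftTranslate_mem_iff {g : Γ} {ω : Ultrafilter Γ} :
    leftTranslate g ω ∈ X.carrier ↔ ω ∈ X.carrier := by
  refine ⟨fun h => ?_, X.left_mem g ω⟩
  have := X.left_mem g⁻¹ _ h
  rwa [leftTranslate_leftTranslate, inv_mul_cancel, leftTranslate_one] at this

theorem infinite_of_nonempty (hX : X.carrier.Nonempty) : Infinite Γ := by
  obtain ⟨ω, hω⟩ := hX
  by_contra hfin
  rw [not_infinite_iff_finite] at hfin
  obtain ⟨x, hx⟩ := ω.eq_pure_of_finite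
  exact X.subset_boundary hω ⟨x, hx.symm⟩

end BoundaryPiece

end Translations

/-! ### Regularity of point masses -/

section Dirac

theorem MeasureTheory.Measure.regular_dirac {K : Type*} [TopologicalSpace K] [T2Space K]
    [MeasurableSpace K] [BorelSpace K] (x : K) : (Measure.dirac x).Regular where
  lt_top_of_isCompact _ _ := measure_lt_top _ _
  outerRegular {A} hA r hr := by
    by_cases hx : x ∈ A
    · refine ⟨Set.univ, Set.subset_univ _, isOpen_univ, ?_⟩
      rw [Measure.dirac_apply_of_mem hx] at hr
      rwa [measure_univ]
    · refine ⟨{x}ᶜ, fun y hy hyx => hx (hyx ▸ hy), isOpen_compl_singleton, ?_⟩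
      rw [Measure.dirac_apply' _ hA, Set.indicator_of_notMem hx] at hr
      rwa [Measure.dirac_apply' _ (measurableSet_singleton x).compl,
        Set.indicator_of_notMem (by simp)]
  innerRegular U hU r hr := by
    by_cases hx : x ∈ U
    · refine ⟨{x}, by simpa using hx, isCompact_singleton, ?_⟩
      rw [Measure.dirac_apply_of_mem hx] at hr
      rwa [Measure.dirac_apply_of_mem (Set.mem_singleton x)]
    · rw [Measure.dirac_apply' _ hU.measurableSet, Set.indicator_of_notMem hx] at hr
      exact absurd hr not_lt_zero

end Dirac

/-! ### The quotient of `ΔΓ` whose proximal piece is `X` -/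

namespace BoundaryPiece

variable {Γ : Type u} [Group Γ] (X : BoundaryPiece Γ)

/-- The continuous functions on `ΔΓ` whose restriction to `X` is right-invariant. -/
def asymptoticallyInvariant : Set C(Ultrafilter Γ, ℂ) :=
  {f | ∀ (h : Γ), ∀ ω ∈ X.carrier, f (rightTranslate h ω) = f ω}

/-- Two points of `ΔΓ` are identified if they are not separated by the functions whose
restriction to `X` is right-invariant. -/
def factorSetoid : Setoid (Ultrafilter Γ) where
  r σ τ := ∀ f ∈ X.asymptoticallyInvariant, f σ = f τ
  iseqv := ⟨fun _ _ _ => rfl, fun h f hf => (h f hf).symm, fun h h' f hf =>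
    (h f hf).trans (h' f hf)⟩

/-- The spectrum of the algebra of functions on `ΔΓ` whose restriction to `X` is
right-invariant, as a quotient of `ΔΓ`. -/
def Factor : Type (max u v) := ULift.{v} (Quotient X.factorSetoid)

instance : TopologicalSpace (Factor.{u, v} X) :=
  inferInstanceAs (TopologicalSpace (ULift.{v} (Quotient X.factorSetoid)))

instance : CompactSpace (Factor.{u, v} X) :=
  inferInstanceAs (CompactSpace (ULift.{v} (Quotient X.factorSetoid)))

instance : MeasurableSpace (Factor.{u, v} X) := borel _

instance : BorelSpace (Factor.{u, v} X) := ⟨rfl⟩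

/-- The quotient map `ΔΓ → Factor X`. -/
def toFactor (σ : Ultrafilter Γ) : Factor.{u, v} X := ULift.up (Quotient.mk X.factorSetoid σ)

theorem isQuotientMap_toFactor : IsQuotientMap (toFactor.{u, v} X) :=
  (Homeomorph.ulift.{v}.symm.isQuotientMap).comp isQuotientMap_quotient_mk'

theorem toFactor_eq_iff {σ τ : Ultrafilter Γ} :
    toFactor.{u, v} X σ = toFactor.{u, v} X τ ↔ ∀ f ∈ X.asymptoticallyInvariant, f σ = f τ :=
  ULift.up_injective.eq_iff.trans (Quotient.eq (r := X.factorSetoid))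

/-- A function on `ΔΓ` which is constant on the fibres of `toFactor`, on the quotient. -/
def factorLift {E : Type*} (f : Ultrafilter Γ → E)
    (hf : ∀ σ τ, toFactor.{u, v} X σ = toFactor.{u, v} X τ → f σ = f τ) (y : Factor.{u, v} X) : E :=
  Quotient.lift (s := X.factorSetoid) f
    (fun σ τ h => hf σ τ (congrArg ULift.up (Quotient.sound h))) y.down

/-- The continuous function on `Factor X` induced by an asymptotically invariant function. -/
def liftInvariant {f : C(Ultrafilter Γ, ℂ)} (hf : f ∈ X.asymptoticallyInvariant) :
    C(Factor.{u, v} X, ℂ) :=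
  ⟨X.factorLift f (fun _ _ h => (toFactor_eq_iff X).1 h f hf),
    (X.isQuotientMap_toFactor.continuous_iff).2 f.continuous⟩

@[simp]
theorem liftInvariant_toFactor {f : C(Ultrafilter Γ, ℂ)} (hf : f ∈ X.asymptoticallyInvariant)
    (σ : Ultrafilter Γ) : X.liftInvariant hf (toFactor.{u, v} X σ) = f σ := rfl

instance : T2Space (Factor.{u, v} X) := by
  refine ⟨fun x y hxy => ?_⟩
  obtain ⟨σ, rfl⟩ := X.isQuotientMap_toFactor.surjective x
  obtain ⟨τ, rfl⟩ := X.isQuotientMap_toFactor.surjective y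
  rw [Ne, toFactor_eq_iff] at hxy
  push Not at hxy
  obtain ⟨f, hf, hne⟩ := hxy
  exact separated_by_continuous (liftInvariant.{u, v} X hf).continuous hne

theorem comp_leftTranslate_mem {f : C(Ultrafilter Γ, ℂ)} (hf : f ∈ X.asymptoticallyInvariant)
    (g : Γ) : f.comp ⟨leftTranslate g, continuous_leftTranslate g⟩ ∈
      X.asymptoticallyInvariant := by
  intro h ω hω
  change f (leftTranslate g (rightTranslate h ω)) = f (leftTranslate g ω)
  rw [leftTranslate_rightTranslate]
  exact hf h _ (X.left_mem g ω hω)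

theorem toFactor_leftTranslate_eq (g : Γ) (σ τ : Ultrafilter Γ)
    (h : toFactor.{u, v} X σ = toFactor.{u, v} X τ) :
    toFactor.{u, v} X (leftTranslate g σ) = toFactor.{u, v} X (leftTranslate g τ) := by
  rw [toFactor_eq_iff] at h ⊢
  exact fun f hf => h _ (X.comp_leftTranslate_mem hf g)

instance : MulAction Γ (Factor.{u, v} X) where
  smul g y := X.factorLift (fun σ => toFactor.{u, v} X (leftTranslate g σ))
    (X.toFactor_leftTranslate_eq g) y
  one_smul y := by
    obtain ⟨σ, rfl⟩ := X.isQuotientMap_toFactor.surjective y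
    exact congrArg (toFactor.{u, v} X) (leftTranslate_one σ)
  mul_smul g h y := by
    obtain ⟨σ, rfl⟩ := X.isQuotientMap_toFactor.surjective y
    exact congrArg (toFactor.{u, v} X) (leftTranslate_leftTranslate g h σ).symm

theorem smul_toFactor (g : Γ) (σ : Ultrafilter Γ) :
    g • toFactor.{u, v} X σ = toFactor.{u, v} X (leftTranslate g σ) := rfl

instance : ContinuousConstSMul Γ (Factor.{u, v} X) where
  continuous_const_smul g := by
    refine (X.isQuotientMap_toFactor.continuous_iff).2 ?_
    exact X.isQuotientMap_toFactor.continuous.comp (continuous_leftTranslate g)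

/-- The action of `Γ` on `Factor X`, with the point mass at the identity of `Γ`. -/
def factorAction : CompactAction.{u, max u v} Γ :=
  have := Measure.regular_dirac (toFactor.{u, v} X (pure 1))
  { space := Factor.{u, v} X
    η := Measure.dirac (toFactor.{u, v} X (pure 1)) }

theorem integral_map_factorAction (f : C(Factor.{u, v} X, ℂ)) (g : Γ) :
    ∫ x, f x ∂((Measure.dirac (toFactor.{u, v} X (pure 1))).map (fun y => g • y)) =
      f (toFactor.{u, v} X (pure g)) := by
  rw [Measure.map_dirac' (continuous_const_smul g).measurable, integral_dirac, smul_toFactor,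
    leftTranslate_pure, mul_one]

/-- The translate of the point mass by `g` is the point mass at the class of `g`, so the limits
along `ω` of the two orbits are evaluations at the classes of `ωh` and of `ω`. -/
theorem mem_proximalPiece_factorAction {ω : Ultrafilter Γ} :
    ω ∈ (factorAction.{u, v} X).proximalPiece ↔
      ∀ (h : Γ), ∀ f ∈ X.asymptoticallyInvariant, f (rightTranslate h ω) = f ω := by
  have key : ∀ (h : Γ) (f : C(Factor.{u, v} X, ℂ)), Tendsto (fun g : Γ =>
      (∫ x, f x ∂((Measure.dirac (toFactor.{u, v} X (pure 1))).map (fun y => (g * h) • y))) -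
        ∫ x, f x ∂((Measure.dirac (toFactor.{u, v} X (pure 1))).map (fun y => g • y))) ω
      (𝓝 (f (toFactor X (rightTranslate h ω)) - f (toFactor X ω))) := by
    intro h f
    simp only [integral_map_factorAction]
    have hc : Continuous fun σ => f (toFactor X σ) :=
      f.continuous.comp X.isQuotientMap_toFactor.continuous
    refine Tendsto.sub ?_ (tendsto_apply_pure hc ω)
    have := tendsto_apply_pure (hc.comp (continuous_rightTranslate h)) ω
    simpa only [Function.comp_apply, rightTranslate_pure] using this
  constructor
  · intro hω h f hf
    have h1 := hω h (X.liftInvariant hf)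
    have h2 := tendsto_nhds_unique (key h (X.liftInvariant hf)) h1
    simpa only [liftInvariant_toFactor, sub_eq_zero] using h2
  · intro hω h f
    have h1 := key h f
    have h2 : toFactor.{u, v} X (rightTranslate h ω) = toFactor.{u, v} X ω :=
      (toFactor_eq_iff X).2 (hω h)
    rw [h2, sub_self] at h1
    exact h1

/-- Such a product vanishes on `X`, where invariance is then automatic. These functions separate
each point off `X` from all other points. -/
theorem clopenIndicator_mul_mem {S : Set Γ} (hS : ∀ ω ∈ X.carrier, S ∉ ω)
    (f : C(Ultrafilter Γ, ℂ)) :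
    clopenIndicator (ultrafilterClopen S) * f ∈ X.asymptoticallyInvariant := by
  have h0 : ∀ ω ∈ X.carrier, (clopenIndicator (ultrafilterClopen S) * f) ω = 0 := fun ω hω => by
    rw [ContinuousMap.mul_apply, clopenIndicator_of_notMem (hS ω hω), zero_mul]
  exact fun h ω hω => (h0 _ (X.right_mem h ω hω)).trans (h0 ω hω).symm

theorem exists_mem_forall_notMem {σ τ : Ultrafilter Γ} (hτ : τ ∉ X.carrier) (hne : σ ≠ τ) :
    ∃ S ∈ τ, S ∉ σ ∧ ∀ ω ∈ X.carrier, S ∉ ω := by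
  obtain ⟨S, hS, h⟩ := exists_mem_of_notMem_closed (X.isClosed'.union isClosed_singleton)
    (τ := τ) (Y := X.carrier ∪ {σ}) (by simpa [hτ] using hne.symm)
  exact ⟨S, hS, h σ (by simp), fun ω hω => h ω (Or.inl hω)⟩

theorem toFactor_ne {σ τ : Ultrafilter Γ} (hτ : τ ∉ X.carrier) (hne : σ ≠ τ) :
    toFactor.{u, v} X σ ≠ toFactor.{u, v} X τ := by
  obtain ⟨S, h1, h2, h3⟩ := X.exists_mem_forall_notMem hτ hne
  intro h
  have := (toFactor_eq_iff X).1 h _ (X.clopenIndicator_mul_mem h3 1)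
  rw [mul_one, clopenIndicator_of_notMem h2, clopenIndicator_of_mem h1] at this
  exact zero_ne_one this

/-- A point off `X` is alone in its class but differs from its translate by any `k ≠ 1`; such a `k`
exists since a nonempty `X` forces `Γ` to be infinite. -/
theorem proximalPiece_factorAction (hX : X.carrier.Nonempty) :
    (factorAction.{u, v} X).proximalPiece = X.carrier := by
  ext ω
  rw [mem_proximalPiece_factorAction]
  refine ⟨fun h => ?_, fun hω h f hf => hf h ω hω⟩
  by_contra hω
  have := X.infinite_of_nonempty hX
  obtain ⟨k, hk⟩ := exists_ne (1 : Γ)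
  exact toFactor_ne.{u, v} X hω (rightTranslate_ne hk ω) ((toFactor_eq_iff X).2 (h k))

/-! ### From an invariant measure on the quotient to an invariant state -/

section InvariantState

open Classical in
/-- The function on `ΔΓ` which is `F` on `X`, and the limit of `F` along the orbit of `ω₀` off
`X`. -/
def orbitExtension (ω₀ : X.carrier) (F : C(X.carrier, ℂ)) (σ : Ultrafilter Γ) : ℂ :=
  if h : σ ∈ X.carrier then F ⟨σ, h⟩ else ultrafilterExtend (fun g => F (X.leftMap g ω₀)) σ

variable {X} (ω₀ : X.carrier)

theorem orbitExtension_of_mem (F : C(X.carrier, ℂ)) {σ : Ultrafilter Γ} (h : σ ∈ X.carrier) :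
    orbitExtension X ω₀ F σ = F ⟨σ, h⟩ := dif_pos h

theorem orbitExtension_of_notMem (F : C(X.carrier, ℂ)) {σ : Ultrafilter Γ} (h : σ ∉ X.carrier) :
    orbitExtension X ω₀ F σ = ultrafilterExtend (fun g => F (X.leftMap g ω₀)) σ := dif_neg h

theorem tendsto_orbit (F : C(X.carrier, ℂ)) {σ : Ultrafilter Γ} (h : σ ∉ X.carrier) :
    Tendsto (fun g => F (X.leftMap g ω₀)) σ (𝓝 (orbitExtension X ω₀ F σ)) := by
  rw [orbitExtension_of_notMem ω₀ F h]
  exact tendsto_ultrafilterExtend (fun g => F.norm_coe_le_norm _) σ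

/-- Uniqueness of limits: an identity need only be checked on `X` and along the orbit of `ω₀`. This
makes `orbitExtension` a unital *-homomorphism into bounded functions, equivariant for left
translations. -/
theorem orbitExtension_eq (F : C(X.carrier, ℂ)) {σ : Ultrafilter Γ} {z : ℂ}
    (h1 : ∀ h : σ ∈ X.carrier, F ⟨σ, h⟩ = z)
    (h2 : σ ∉ X.carrier → Tendsto (fun g => F (X.leftMap g ω₀)) σ (𝓝 z)) :
    orbitExtension X ω₀ F σ = z := by
  by_cases h : σ ∈ X.carrier
  · rw [orbitExtension_of_mem ω₀ F h, h1 h]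
  · exact tendsto_nhds_unique (tendsto_orbit ω₀ F h) (h2 h)

theorem orbitExtension_add (F G : C(X.carrier, ℂ)) (σ : Ultrafilter Γ) :
    orbitExtension X ω₀ (F + G) σ = orbitExtension X ω₀ F σ + orbitExtension X ω₀ G σ :=
  orbitExtension_eq ω₀ _
    (fun h => by rw [orbitExtension_of_mem ω₀ _ h, orbitExtension_of_mem ω₀ _ h]; rfl)
    (fun h => (tendsto_orbit ω₀ F h).add (tendsto_orbit ω₀ G h))

theorem orbitExtension_mul (F G : C(X.carrier, ℂ)) (σ : Ultrafilter Γ) :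
    orbitExtension X ω₀ (F * G) σ = orbitExtension X ω₀ F σ * orbitExtension X ω₀ G σ :=
  orbitExtension_eq ω₀ _
    (fun h => by rw [orbitExtension_of_mem ω₀ _ h, orbitExtension_of_mem ω₀ _ h]; rfl)
    (fun h => (tendsto_orbit ω₀ F h).mul (tendsto_orbit ω₀ G h))

theorem orbitExtension_smul (c : ℂ) (F : C(X.carrier, ℂ)) (σ : Ultrafilter Γ) :
    orbitExtension X ω₀ (c • F) σ = c * orbitExtension X ω₀ F σ :=
  orbitExtension_eq ω₀ _ (fun h => by rw [orbitExtension_of_mem ω₀ _ h]; rfl)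
    (fun h => (tendsto_orbit ω₀ F h).const_mul c)

theorem orbitExtension_star (F : C(X.carrier, ℂ)) (σ : Ultrafilter Γ) :
    orbitExtension X ω₀ (star F) σ = star (orbitExtension X ω₀ F σ) :=
  orbitExtension_eq ω₀ _ (fun h => by rw [orbitExtension_of_mem ω₀ _ h]; rfl)
    (fun h => (tendsto_orbit ω₀ F h).star)

theorem orbitExtension_one (σ : Ultrafilter Γ) : orbitExtension X ω₀ 1 σ = 1 :=
  orbitExtension_eq ω₀ _ (fun _ => rfl) (fun _ => tendsto_const_nhds)

theorem orbitExtension_leftAct (g : Γ) (F : C(X.carrier, ℂ)) (σ : Ultrafilter Γ) :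
    orbitExtension X ω₀ (X.leftAct g F) σ = orbitExtension X ω₀ F (leftTranslate g⁻¹ σ) := by
  refine orbitExtension_eq ω₀ _ (fun h => ?_) (fun h => ?_)
  · rw [orbitExtension_of_mem ω₀ _ (X.left_mem g⁻¹ σ h)]
    rfl
  · have h' : leftTranslate g⁻¹ σ ∉ X.carrier := fun h' => h (X.leftTranslate_mem_iff.1 h')
    have := tendsto_map'_iff.1 (tendsto_orbit ω₀ F h')
    refine this.congr fun x => ?_
    have : X.leftMap (g⁻¹ * x) ω₀ = X.leftMap g⁻¹ (X.leftMap x ω₀) :=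
      Subtype.ext (leftTranslate_leftTranslate g⁻¹ x ω₀.1).symm
    exact congrArg F this

theorem norm_orbitExtension_le (F : C(X.carrier, ℂ)) (σ : Ultrafilter Γ) :
    ‖orbitExtension X ω₀ F σ‖ ≤ ‖F‖ := by
  by_cases h : σ ∈ X.carrier
  · rw [orbitExtension_of_mem ω₀ F h]
    exact F.norm_coe_le_norm _
  · exact le_of_tendsto (tendsto_orbit ω₀ F h).norm (Eventually.of_forall fun g =>
      F.norm_coe_le_norm _)

theorem exists_asymptoticallyInvariant_extension (F : X.rightInvariant) :
    ∃ G ∈ X.asymptoticallyInvariant, ∀ ω : X.carrier, G ω = (F : C(X.carrier, ℂ)) ω := by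
  obtain ⟨G, hG⟩ := ContinuousMap.exists_restrict_eq X.isClosed' (F : C(X.carrier, ℂ))
  have hG' : ∀ ω : X.carrier, G ω = (F : C(X.carrier, ℂ)) ω := fun ω => DFunLike.congr_fun hG ω
  refine ⟨G, fun h ω hω => ?_, hG'⟩
  exact (hG' (X.rightMap h ⟨ω, hω⟩)).trans
    ((DFunLike.congr_fun (F.2 h) ⟨ω, hω⟩).trans (hG' ⟨ω, hω⟩).symm)

/-- Distinct points with the same class both lie in `X`, where a Tietze extension of `F` is one of
the functions defining the quotient. -/
theorem orbitExtension_eq_of_toFactor_eq (F : X.rightInvariant) (σ τ : Ultrafilter Γ)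
    (h : toFactor.{u, v} X σ = toFactor.{u, v} X τ) :
    orbitExtension X ω₀ F σ = orbitExtension X ω₀ F τ := by
  by_cases hne : σ = τ
  · rw [hne]
  have hτ : τ ∈ X.carrier := by
    by_contra hτ
    exact toFactor_ne.{u, v} X hτ hne h
  have hσ : σ ∈ X.carrier := by
    by_contra hσ
    exact toFactor_ne.{u, v} X hσ (Ne.symm hne) h.symm
  obtain ⟨G, hG, hGF⟩ := exists_asymptoticallyInvariant_extension F
  rw [orbitExtension_of_mem ω₀ _ hσ, orbitExtension_of_mem ω₀ _ hτ, ← hGF, ← hGF]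
  exact (toFactor_eq_iff X).1 h G hG

/-- The function `orbitExtension` on the quotient `Factor X`. -/
def factorExtension (F : X.rightInvariant) : Factor.{u, v} X → ℂ :=
  X.factorLift (orbitExtension X ω₀ F) (orbitExtension_eq_of_toFactor_eq ω₀ F)

theorem factorExtension_toFactor (F : X.rightInvariant) (σ : Ultrafilter Γ) :
    factorExtension ω₀ F (toFactor.{u, v} X σ) = orbitExtension X ω₀ F σ := rfl

/-- The function may jump across the image `Z` of `X`, but it is continuous on the closed set `Z`
and on its open complement. -/
theorem measurable_factorExtension (F : X.rightInvariant) :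
    Measurable (factorExtension.{u, v} ω₀ F) := by
  classical
  let Z : Set (Factor.{u, v} X) := toFactor.{u, v} X '' X.carrier
  have hZ : IsClosed Z :=
    (X.isClosed'.isCompact.image X.isQuotientMap_toFactor.continuous).isClosed
  have h1 : ContinuousOn (factorExtension.{u, v} ω₀ F) Z := by
    obtain ⟨G, hG, hGF⟩ := exists_asymptoticallyInvariant_extension F
    refine (liftInvariant.{u, v} X hG).continuous.continuousOn.congr ?_
    rintro _ ⟨σ, hσ, rfl⟩
    rw [factorExtension_toFactor, orbitExtension_of_mem ω₀ _ hσ, liftInvariant_toFactor,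
      ← hGF ⟨σ, hσ⟩]
  have h2 : ContinuousOn (factorExtension.{u, v} ω₀ F) Zᶜ := by
    refine continuousOn_of_forall_continuousAt fun y hy => ?_
    obtain ⟨τ, rfl⟩ := X.isQuotientMap_toFactor.surjective y
    have hτ : τ ∉ X.carrier := fun h => hy ⟨τ, h, rfl⟩
    -- A clopen neighbourhood of `τ` missing `X`: there the extension agrees with the lift of a
    -- continuous function cut off by the indicator of `S`.
    obtain ⟨S, hSτ, hS⟩ := exists_mem_of_notMem_closed X.isClosed' hτ
    have hm1 := X.clopenIndicator_mul_mem hS 1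
    have hm2 := X.clopenIndicator_mul_mem hS
      (ultrafilterExtend fun g => (F : C(X.carrier, ℂ)) (X.leftMap g ω₀))
    have hev : ∀ᶠ z in 𝓝 (toFactor.{u, v} X τ), liftInvariant.{u, v} X hm1 z ≠ 0 := by
      refine (liftInvariant.{u, v} X hm1).continuous.continuousAt.eventually_ne ?_
      rw [liftInvariant_toFactor, mul_one, clopenIndicator_of_mem hSτ]
      exact one_ne_zero
    refine (liftInvariant.{u, v} X hm2).continuous.continuousAt.congr ?_
    filter_upwards [hev] with z hz
    obtain ⟨σ, rfl⟩ := X.isQuotientMap_toFactor.surjective z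
    have hSσ : S ∈ σ := by
      by_contra hSσ
      rw [liftInvariant_toFactor, mul_one, clopenIndicator_of_notMem hSσ] at hz
      exact hz rfl
    rw [factorExtension_toFactor, orbitExtension_of_notMem ω₀ _ (fun h => hS σ h hSσ),
      liftInvariant_toFactor, ContinuousMap.mul_apply, clopenIndicator_of_mem hSσ, one_mul]
  have := h1.measurable_piecewise h2 hZ.measurableSet
  rwa [Set.piecewise_same] at this

theorem integrable_factorExtension (μ : Measure (Factor.{u, v} X)) [IsFiniteMeasure μ]
    (F : X.rightInvariant) : Integrable (factorExtension.{u, v} ω₀ F) μ := by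
  refine Integrable.of_bound (measurable_factorExtension ω₀ F).aestronglyMeasurable
    ‖(F : C(X.carrier, ℂ))‖ (ae_of_all _ fun y => ?_)
  obtain ⟨σ, rfl⟩ := X.isQuotientMap_toFactor.surjective y
  exact norm_orbitExtension_le ω₀ _ σ

theorem hasInvariantState_of_factorAction (hX : X.carrier.Nonempty)
    (h : (factorAction.{u, v} X).HasInvariantProbability) : X.HasInvariantState := by
  obtain ⟨ω₀, hω₀⟩ := hX
  let p : X.carrier := ⟨ω₀, hω₀⟩
  obtain ⟨(μ : Measure (Factor.{u, v} X)), hμ, -, hinv⟩ := h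
  have hμ' : IsProbabilityMeasure (α := Factor.{u, v} X) μ := hμ
  have hinv' : ∀ g : Γ, μ.map (fun x : Factor.{u, v} X => g • x) = μ := hinv
  refine ⟨{ toFun := fun F => ∫ y, factorExtension p F y ∂μ
            map_add' := fun F G => ?_
            map_smul' := fun c F => ?_ }, ⟨fun F => ?_, ?_⟩, fun g F => ?_⟩
  · rw [← integral_add (integrable_factorExtension p μ F) (integrable_factorExtension p μ G)]
    refine integral_congr_ae (ae_of_all _ fun y => ?_)
    obtain ⟨σ, rfl⟩ := X.isQuotientMap_toFactor.surjective y
    exact orbitExtension_add p _ _ σ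
  · rw [RingHom.id_apply, smul_eq_mul, ← integral_const_mul]
    refine integral_congr_ae (ae_of_all _ fun y => ?_)
    obtain ⟨σ, rfl⟩ := X.isQuotientMap_toFactor.surjective y
    exact orbitExtension_smul p _ _ σ
  · refine integral_nonneg fun y => ?_
    obtain ⟨σ, rfl⟩ := X.isQuotientMap_toFactor.surjective y
    have : factorExtension p (star F * F) (toFactor.{u, v} X σ) =
        star (orbitExtension X p F σ) * orbitExtension X p F σ :=
      (orbitExtension_mul p _ _ σ).trans (congrArg (· * _) (orbitExtension_star p _ σ))
    change (0 : ℂ) ≤ factorExtension p (star F * F) (toFactor.{u, v} X σ)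
    rw [this]
    exact star_mul_self_nonneg _
  · have : ∀ y : Factor.{u, v} X, factorExtension p 1 y = 1 := fun y => by
      obtain ⟨σ, rfl⟩ := X.isQuotientMap_toFactor.surjective y
      exact orbitExtension_one p σ
    change ∫ y, factorExtension p 1 y ∂μ = 1
    simp [this]
  · change ∫ y, factorExtension p (X.leftActInvariant g F) y ∂μ = ∫ y, factorExtension p F y ∂μ
    conv_rhs => rw [← hinv' g⁻¹]
    rw [integral_map (continuous_const_smul g⁻¹).measurable.aemeasurable
      (measurable_factorExtension p F).aestronglyMeasurable]
    refine integral_congr_ae (ae_of_all _ fun y => ?_)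
    obtain ⟨σ, rfl⟩ := X.isQuotientMap_toFactor.surjective y
    exact orbitExtension_leftAct p g _ σ

theorem eqProximal_of_not_hasInvariantState (hX : X.carrier.Nonempty)
    (h : ¬ X.HasInvariantState) : EqProximal.{u, max u v} X :=
  ⟨factorAction.{u, v} X, fun h' => h (hasInvariantState_of_factorAction hX h'),
    (proximalPiece_factorAction X hX).symm⟩

end InvariantState

end BoundaryPiece

/-! ### Indicators of closed sets as elements of `C(K)**` -/

section ClopenLimits

open TopologicalSpace

variable {K : Type*} [TopologicalSpace K]

/-- The filter of small clopen sets containing `Y`. -/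
def clopenNhds (Y : Set K) : Filter (Clopens K) where
  sets := {s | ∃ C : Clopens K, Y ⊆ C ∧ ∀ D : Clopens K, Y ⊆ D → D ≤ C → D ∈ s}
  univ_sets := ⟨⊤, Set.subset_univ _, fun _ _ _ => trivial⟩
  sets_of_superset := fun ⟨C, h1, h2⟩ hst => ⟨C, h1, fun D h3 h4 => hst (h2 D h3 h4)⟩
  inter_sets := fun ⟨C, h1, h2⟩ ⟨C', h1', h2'⟩ => ⟨C ⊓ C', Set.subset_inter h1 h1',
    fun D h3 h4 => ⟨h2 D h3 (h4.trans inf_le_left), h2' D h3 (h4.trans inf_le_right)⟩⟩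

theorem mem_clopenNhds {Y : Set K} {s : Set (Clopens K)} : s ∈ clopenNhds Y ↔
    ∃ C : Clopens K, Y ⊆ C ∧ ∀ D : Clopens K, Y ⊆ D → D ≤ C → D ∈ s := Iff.rfl

instance (Y : Set K) : (clopenNhds Y).NeBot :=
  neBot_iff.2 fun h => by
    obtain ⟨C, h1, h2⟩ := mem_clopenNhds.1 (empty_mem_iff_bot.2 h)
    exact h2 C h1 le_rfl

theorem clopenNhds_eventually_subset (Y : Set K) : ∀ᶠ C : Clopens K in clopenNhds Y, Y ⊆ C :=
  mem_clopenNhds.2 ⟨⊤, Set.subset_univ _, fun _ h _ => h⟩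

theorem clopenNhds_eventually_subset_of_isOpen [CompactSpace K] [T2Space K]
    [TotallyDisconnectedSpace K] {Y U : Set K} (hY : IsClosed Y) (hU : IsOpen U) (hYU : Y ⊆ U) :
    ∀ᶠ C : Clopens K in clopenNhds Y, (C : Set K) ⊆ U := by
  obtain ⟨C, hC, h1, h2⟩ := exists_clopen_of_closed_subset_open hY hU hYU
  exact mem_clopenNhds.2 ⟨⟨C, hC⟩, h1, fun D _ h => Set.Subset.trans h h2⟩

theorem tendsto_clopenNhds_iff {β : Type*} {l : Filter β} {F : β → Clopens K} {Z : Set K} :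
    Tendsto F l (clopenNhds Z) ↔ (∀ᶠ b in l, Z ⊆ F b) ∧
      ∀ C : Clopens K, Z ⊆ C → ∀ᶠ b in l, F b ≤ C := by
  refine ⟨fun h => ⟨h.eventually (clopenNhds_eventually_subset Z), fun C hC =>
    h.eventually (mem_clopenNhds.2 ⟨C, hC, fun _ _ h => h⟩)⟩, fun ⟨h1, h2⟩ s hs => ?_⟩
  obtain ⟨C, hC, h⟩ := mem_clopenNhds.1 hs
  rw [mem_map]
  filter_upwards [h1, h2 C hC] with b hb1 hb2 using h _ hb1 hb2

theorem clopenIndicator_nonneg (C : Clopens K) (x : K) : 0 ≤ clopenIndicator C x := by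
  by_cases h : x ∈ C
  · rw [clopenIndicator_of_mem h]; exact zero_le_one
  · rw [clopenIndicator_of_notMem h]

theorem clopenIndicator_mono {C D : Clopens K} (h : C ≤ D) (x : K) :
    clopenIndicator C x ≤ clopenIndicator D x := by
  by_cases hC : x ∈ C
  · rw [clopenIndicator_of_mem hC, clopenIndicator_of_mem (h hC)]
  · rw [clopenIndicator_of_notMem hC]
    exact clopenIndicator_nonneg D x

theorem norm_clopenIndicator_apply_le (C : Clopens K) (x : K) : ‖clopenIndicator C x‖ ≤ 1 := by
  by_cases h : x ∈ C
  · simp [clopenIndicator_of_mem h]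
  · simp [clopenIndicator_of_notMem h]

theorem clopenIndicator_sup_add_inf (C D : Clopens K) :
    clopenIndicator (C ⊔ D) + clopenIndicator (C ⊓ D) = clopenIndicator C + clopenIndicator D := by
  ext x
  simp only [ContinuousMap.add_apply]
  by_cases h1 : x ∈ C <;> by_cases h2 : x ∈ D
  · rw [clopenIndicator_of_mem (C := C ⊔ D) (Or.inl h1),
      clopenIndicator_of_mem (C := C ⊓ D) ⟨h1, h2⟩, clopenIndicator_of_mem h1,
      clopenIndicator_of_mem h2]
  · rw [clopenIndicator_of_mem (C := C ⊔ D) (Or.inl h1),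
      clopenIndicator_of_notMem (C := C ⊓ D) (fun h => h2 h.2), clopenIndicator_of_mem h1,
      clopenIndicator_of_notMem h2]
  · rw [clopenIndicator_of_mem (C := C ⊔ D) (Or.inr h2),
      clopenIndicator_of_notMem (C := C ⊓ D) (fun h => h1 h.1), clopenIndicator_of_notMem h1,
      clopenIndicator_of_mem h2, add_comm]
  · rw [clopenIndicator_of_notMem (C := C ⊔ D) (fun h => h.elim h1 h2),
      clopenIndicator_of_notMem (C := C ⊓ D) (fun h => h1 h.1), clopenIndicator_of_notMem h1,
      clopenIndicator_of_notMem h2]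

variable [CompactSpace K]

/-- The differences of successive indicators are nonnegative with sum at most `1`. Combining them
with the phases that make each `ψ`-value positive gives a function of norm at most `1`. -/
theorem sum_norm_antitone_le (ψ : StrongDual ℂ C(K, ℂ)) (C : ℕ → Clopens K) (hC : Antitone C)
    (N : ℕ) : ∑ n ∈ Finset.range N,
      ‖ψ (clopenIndicator (C n)) - ψ (clopenIndicator (C (n + 1)))‖ ≤ ‖ψ‖ := by
  let d : ℕ → C(K, ℂ) := fun n => clopenIndicator (C n) - clopenIndicator (C (n + 1))
  have hphase : ∀ z : ℂ, ∃ c : ℂ, ‖c‖ ≤ 1 ∧ c * z = (‖z‖ : ℂ) := fun z => by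
    by_cases hz : z = 0
    · exact ⟨0, by simp, by simp [hz]⟩
    · have hz' : (‖z‖ : ℂ) ≠ 0 := by simpa using hz
      refine ⟨star z / ‖z‖, ?_, ?_⟩
      · rw [norm_div, norm_star, Complex.norm_real, norm_norm, div_self (norm_ne_zero_iff.2 hz)]
      · have : star z * z = (‖z‖ : ℂ) ^ 2 := Complex.conj_mul' z
        rw [div_mul_eq_mul_div, this]
        field_simp
  choose c hc1 hc2 using fun n => hphase (ψ (d n))
  have h1 : ‖∑ n ∈ Finset.range N, c n • d n‖ ≤ 1 := by
    refine (ContinuousMap.norm_le _ zero_le_one).2 fun x => ?_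
    have hd : ∀ n, ‖d n x‖ = (clopenIndicator (C n) x).re - (clopenIndicator (C (n + 1)) x).re := by
      intro n
      have h0 : 0 ≤ d n x := sub_nonneg.2 (clopenIndicator_mono (hC n.le_succ) x)
      rw [← Complex.sub_re]
      exact congrArg Complex.re (RCLike.norm_of_nonneg' h0)
    calc ‖(∑ n ∈ Finset.range N, c n • d n) x‖ ≤ ∑ n ∈ Finset.range N, ‖d n x‖ := by
          rw [ContinuousMap.sum_apply]
          refine (norm_sum_le _ _).trans (Finset.sum_le_sum fun n _ => ?_)
          rw [ContinuousMap.smul_apply, norm_smul]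
          exact mul_le_of_le_one_left (norm_nonneg _) (hc1 n)
      _ = (clopenIndicator (C 0) x).re - (clopenIndicator (C N) x).re := by
          simp only [hd]
          rw [Finset.sum_range_sub']
      _ ≤ 1 := by
          have h2 := (Complex.le_def.1 (clopenIndicator_nonneg (C N) x)).1
          have h3 := (Complex.re_le_norm _).trans (norm_clopenIndicator_apply_le (C 0) x)
          simp only [Complex.zero_re] at h2
          linarith
  have h2 : ψ (∑ n ∈ Finset.range N, c n • d n) =
      ((∑ n ∈ Finset.range N, ‖ψ (d n)‖ : ℝ) : ℂ) := by
    rw [map_sum]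
    push_cast
    exact Finset.sum_congr rfl fun n _ => by rw [map_smul, smul_eq_mul, hc2]
  have h3 := ψ.le_of_opNorm_le_of_le le_rfl h1
  rw [h2, mul_one, Complex.norm_real] at h3
  have h4 := (le_abs_self _).trans h3
  simpa only [d, map_sub] using h4

/-- If the net were not Cauchy, one could choose a decreasing sequence of clopen sets with jumps at
least `ε / 2`, contradicting the bounded variation of `ψ` along such sequences. -/
theorem exists_tendsto_clopenIndicator (Y : Set K) (ψ : StrongDual ℂ C(K, ℂ)) :
    ∃ z : ℂ, Tendsto (fun C => ψ (clopenIndicator C)) (clopenNhds Y) (𝓝 z) := by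
  refine cauchy_map_iff_exists_tendsto.1 ?_
  refine Metric.cauchy_iff.2 ⟨inferInstance, fun ε hε => ?_⟩
  by_contra hcon
  have hstep : ∀ C : {C : Clopens K // Y ⊆ C}, ∃ D : {C : Clopens K // Y ⊆ C}, D.1 ≤ C.1 ∧
      ε / 2 ≤ ‖ψ (clopenIndicator C.1) - ψ (clopenIndicator D.1)‖ := by
    intro C
    by_contra! hD
    refine hcon ⟨_, image_mem_map (mem_clopenNhds.2 ⟨C.1, C.2, fun D h1 h2 =>
      (⟨h1, h2⟩ : D ∈ {D : Clopens K | Y ⊆ D ∧ D ≤ C.1})⟩), ?_⟩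
    rintro _ ⟨D, ⟨h1, h2⟩, rfl⟩ _ ⟨D', ⟨h1', h2'⟩, rfl⟩
    have e1 := hD ⟨D, h1⟩ h2
    have e2 := hD ⟨D', h1'⟩ h2'
    rw [← dist_eq_norm] at e1 e2
    calc dist (ψ (clopenIndicator D)) (ψ (clopenIndicator D')) ≤ _ + _ :=
          dist_triangle_left _ _ (ψ (clopenIndicator C.1))
      _ < ε / 2 + ε / 2 := add_lt_add e1 e2
      _ = ε := add_halves ε
  choose next hnext1 hnext2 using hstep
  let S : ℕ → {C : Clopens K // Y ⊆ C} := fun n => next^[n] ⟨⊤, Set.subset_univ _⟩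
  have hS : ∀ n, S (n + 1) = next (S n) := fun n => Function.iterate_succ_apply' next n _
  have hanti : Antitone fun n => (S n).1 := antitone_nat_of_succ_le fun n => by
    rw [hS]
    exact hnext1 _
  obtain ⟨N, hN⟩ := exists_nat_gt (‖ψ‖ / (ε / 2))
  rw [div_lt_iff₀ (by positivity)] at hN
  have h1 := sum_norm_antitone_le ψ (fun n => (S n).1) hanti N
  have h2 : (N : ℝ) * (ε / 2) ≤ ∑ n ∈ Finset.range N,
      ‖ψ (clopenIndicator (S n).1) - ψ (clopenIndicator (S (n + 1)).1)‖ := by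
    rw [← nsmul_eq_mul]
    conv_lhs => rw [← Finset.card_range N]
    refine Finset.card_nsmul_le_sum _ _ _ fun n _ => ?_
    rw [hS]
    exact hnext2 _
  linarith

theorem exists_bidualRestrict (Y : Set K) (b : C(K, ℂ)) : ∃ m : Bidual C(K, ℂ),
    ∀ ψ : StrongDual ℂ C(K, ℂ),
      Tendsto (fun C => ψ (b * clopenIndicator C)) (clopenNhds Y) (𝓝 (m ψ)) := by
  choose m hm using fun ψ : StrongDual ℂ C(K, ℂ) =>
    exists_tendsto_clopenIndicator Y (ψ.comp (ContinuousLinearMap.mul ℂ C(K, ℂ) b))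
  refine ⟨LinearMap.mkContinuous { toFun := m, map_add' := fun ψ ξ => ?_,
                                   map_smul' := fun c ψ => ?_ } ‖b‖ fun ψ => ?_, hm⟩
  · exact tendsto_nhds_unique (hm (ψ + ξ)) ((hm ψ).add (hm ξ))
  · exact tendsto_nhds_unique (hm (c • ψ)) ((hm ψ).const_mul c)
  · refine le_of_tendsto (hm ψ).norm (Eventually.of_forall fun C => ?_)
    rw [mul_comm ‖b‖]
    refine ψ.le_of_opNorm_le_of_le le_rfl ?_
    refine (ContinuousMap.norm_le _ (norm_nonneg b)).2 fun x => ?_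
    change ‖b x * clopenIndicator C x‖ ≤ _
    rw [norm_mul]
    exact (mul_le_of_le_one_right (norm_nonneg _) (norm_clopenIndicator_apply_le C x)).trans
      (b.norm_coe_le_norm x)

/-- The product of `b ∈ C(K)` with the indicator function of the closed set `Y`, as an element of
`C(K)**`. -/
def bidualRestrict (Y : Set K) (b : C(K, ℂ)) : Bidual C(K, ℂ) :=
  (exists_bidualRestrict Y b).choose

theorem tendsto_bidualRestrict (Y : Set K) (b : C(K, ℂ)) (ψ : StrongDual ℂ C(K, ℂ)) :
    Tendsto (fun C => ψ (b * clopenIndicator C)) (clopenNhds Y) (𝓝 (bidualRestrict Y b ψ)) :=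
  (exists_bidualRestrict Y b).choose_spec ψ

theorem bidualRestrict_add (Y : Set K) (b c : C(K, ℂ)) :
    bidualRestrict Y (b + c) = bidualRestrict Y b + bidualRestrict Y c := by
  ext ψ
  refine tendsto_nhds_unique (tendsto_bidualRestrict Y (b + c) ψ) ?_
  simp only [add_mul, map_add]
  exact (tendsto_bidualRestrict Y b ψ).add (tendsto_bidualRestrict Y c ψ)

theorem bidualRestrict_smul (Y : Set K) (a : ℂ) (b : C(K, ℂ)) :
    bidualRestrict Y (a • b) = a • bidualRestrict Y b := by
  ext ψ
  refine tendsto_nhds_unique (tendsto_bidualRestrict Y (a • b) ψ) ?_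
  simp only [smul_mul_assoc, map_smul]
  exact (tendsto_bidualRestrict Y b ψ).const_smul a

theorem bidualStar_bidualRestrict (Y : Set K) (b : C(K, ℂ)) :
    Bidual.bidualStar (bidualRestrict Y b) = bidualRestrict Y (star b) := by
  ext ψ
  rw [Bidual.bidualStar_apply]
  refine tendsto_nhds_unique ?_ (tendsto_bidualRestrict Y (star b) ψ)
  refine (tendsto_bidualRestrict Y b (Bidual.dualStar ψ)).star.congr fun C => ?_
  rw [Bidual.dualStar_apply, star_star]
  congr 1
  ext x
  change star (b x * clopenIndicator C x) = star (b x) * clopenIndicator C x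
  rw [star_mul', (IsSelfAdjoint.of_nonneg (clopenIndicator_nonneg C x)).star_eq]

theorem bidualRestrict_univ (b : C(K, ℂ)) :
    bidualRestrict Set.univ b = NormedSpace.inclusionInDoubleDual ℂ C(K, ℂ) b := by
  ext ψ
  refine tendsto_nhds_unique (tendsto_bidualRestrict Set.univ b ψ) ?_
  refine tendsto_const_nhds.congr' ?_
  filter_upwards [clopenNhds_eventually_subset (Set.univ : Set K)] with C hC
  have : b * clopenIndicator C = b := by
    ext x
    rw [ContinuousMap.mul_apply, clopenIndicator_of_mem (C := C) (hC trivial), mul_one]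
  rw [this]
  rfl

variable [T2Space K] [TotallyDisconnectedSpace K]

/-- Near `Y` the function `b` is uniformly small, so `b * clopenIndicator C` tends to `0` in norm.
-/
theorem bidualRestrict_eq_zero {Y : Set K} (hY : IsClosed Y) {b : C(K, ℂ)}
    (hb : ∀ x ∈ Y, b x = 0) : bidualRestrict Y b = 0 := by
  ext ψ
  refine tendsto_nhds_unique (tendsto_bidualRestrict Y b ψ) ?_
  have h : Tendsto (fun C => b * clopenIndicator C) (clopenNhds Y) (𝓝 0) := by
    rw [Metric.tendsto_nhds]
    intro ε hε
    have hev := clopenNhds_eventually_subset_of_isOpen hY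
      (isOpen_lt (continuous_norm.comp b.continuous) (continuous_const (y := ε / 2)))
      (fun x hx => by
        change ‖b x‖ < ε / 2
        rw [hb x hx, norm_zero]
        positivity)
    filter_upwards [hev] with C hC
    rw [dist_zero_right]
    refine lt_of_le_of_lt ((ContinuousMap.norm_le _ (half_pos hε).le).2 fun x => ?_)
      (half_lt_self hε)
    change ‖b x * clopenIndicator C x‖ ≤ _
    by_cases hx : x ∈ C
    · rw [clopenIndicator_of_mem hx, mul_one]
      exact le_of_lt (hC hx)
    · rw [clopenIndicator_of_notMem hx, mul_zero, norm_zero]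
      positivity
  have h' := (ψ.continuous.tendsto 0).comp h
  rw [map_zero] at h'
  exact h'

theorem bidualRestrict_congr {Y : Set K} (hY : IsClosed Y) {b c : C(K, ℂ)}
    (hbc : ∀ x ∈ Y, b x = c x) : bidualRestrict Y b = bidualRestrict Y c := by
  have h := bidualRestrict_add Y c (b - c)
  rw [bidualRestrict_eq_zero hY (b := b - c) (fun x hx => by simp [hbc x hx]), add_zero,
    add_sub_cancel] at h
  exact h

/-- The inner limit already restricts to `Y`, where the indicator in the outer net equals `1`; so
the outer net is eventually constant. -/
theorem arensMul_bidualRestrict {Y : Set K} (hY : IsClosed Y) (a b : C(K, ℂ)) :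
    Bidual.arensMul (bidualRestrict Y a) (bidualRestrict Y b) = bidualRestrict Y (a * b) := by
  ext ψ
  have h : ∀ c, Bidual.actDual (bidualRestrict Y b) ψ c = bidualRestrict Y (c * b) ψ := by
    intro c
    rw [Bidual.actDual_apply]
    refine tendsto_nhds_unique (tendsto_bidualRestrict Y b _) ?_
    refine (tendsto_bidualRestrict Y (c * b) ψ).congr fun C => ?_
    rw [mul_assoc]
    rfl
  refine tendsto_nhds_unique (tendsto_bidualRestrict Y a (Bidual.actDual (bidualRestrict Y b) ψ)) ?_
  refine tendsto_const_nhds.congr' ?_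
  filter_upwards [clopenNhds_eventually_subset Y] with C hC
  rw [h]
  refine congrArg (fun m : Bidual C(K, ℂ) => m ψ) (bidualRestrict_congr hY fun x hx => ?_)
  simp only [ContinuousMap.mul_apply]
  rw [clopenIndicator_of_mem (C := C) (hC hx), mul_one]

/-- Inclusion–exclusion holds for clopen sets and passes to the limit, because joins and meets of
small neighbourhoods of `Y` and `Z` are small neighbourhoods of the union and the intersection. -/
theorem bidualRestrict_union_add_inter {Y Z : Set K} (hY : IsClosed Y) (hZ : IsClosed Z)
    (b : C(K, ℂ)) : bidualRestrict (Y ∪ Z) b + bidualRestrict (Y ∩ Z) b =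
      bidualRestrict Y b + bidualRestrict Z b := by
  ext ψ
  have hsup : Tendsto (fun p : Clopens K × Clopens K => p.1 ⊔ p.2)
      (clopenNhds Y ×ˢ clopenNhds Z) (clopenNhds (Y ∪ Z)) := by
    refine tendsto_clopenNhds_iff.2 ⟨?_, fun C hC => ?_⟩
    · filter_upwards [(clopenNhds_eventually_subset Y).prod_mk (clopenNhds_eventually_subset Z)]
        with p hp using Set.union_subset_union hp.1 hp.2
    · filter_upwards [(clopenNhds_eventually_subset_of_isOpen hY C.isClopen.2
        (Set.subset_union_left.trans hC)).prod_mk (clopenNhds_eventually_subset_of_isOpen hZ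
        C.isClopen.2 (Set.subset_union_right.trans hC))] with p hp
      exact sup_le hp.1 hp.2
  have hinf : Tendsto (fun p : Clopens K × Clopens K => p.1 ⊓ p.2)
      (clopenNhds Y ×ˢ clopenNhds Z) (clopenNhds (Y ∩ Z)) := by
    refine tendsto_clopenNhds_iff.2 ⟨?_, fun C hC => ?_⟩
    · filter_upwards [(clopenNhds_eventually_subset Y).prod_mk (clopenNhds_eventually_subset Z)]
        with p hp using Set.inter_subset_inter hp.1 hp.2
    · have h1 : (C : Set K) ∈ 𝓝ˢ (Y ∩ Z) := C.isClopen.2.mem_nhdsSet.2 hC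
      -- By compactness, a neighbourhood of the intersection contains the intersection of
      -- neighbourhoods of `Y` and `Z`.
      rw [hY.isCompact.nhdsSet_inter_eq hZ.isCompact] at h1
      obtain ⟨U, hU, V, hV, hUV⟩ := Filter.mem_inf_iff_superset.1 h1
      obtain ⟨U', hU'o, hYU', hU'U⟩ := mem_nhdsSet_iff_exists.1 hU
      obtain ⟨V', hV'o, hZV', hV'V⟩ := mem_nhdsSet_iff_exists.1 hV
      filter_upwards [(clopenNhds_eventually_subset_of_isOpen hY hU'o hYU').prod_mk
        (clopenNhds_eventually_subset_of_isOpen hZ hV'o hZV')] with p hp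
      exact fun x hx => hUV ⟨hU'U (hp.1 hx.1), hV'V (hp.2 hx.2)⟩
  have h1 := ((tendsto_bidualRestrict (Y ∪ Z) b ψ).comp hsup).add
    ((tendsto_bidualRestrict (Y ∩ Z) b ψ).comp hinf)
  have h2 := ((tendsto_bidualRestrict Y b ψ).comp (tendsto_fst (g := clopenNhds Z))).add
    ((tendsto_bidualRestrict Z b ψ).comp (tendsto_snd (f := clopenNhds Y)))
  refine tendsto_nhds_unique (h1.congr fun p => ?_) h2
  simp only [Function.comp_apply]
  rw [← map_add, ← mul_add, clopenIndicator_sup_add_inf, mul_add, map_add]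

theorem secondTranspose_bidualRestrict {Y : Set K} (hY : IsClosed Y) (θ : C(K, K))
    (T : C(K, ℂ) →L[ℂ] C(K, ℂ)) (hT : ∀ f, T f = f.comp θ) (b : C(K, ℂ)) :
    Bidual.secondTranspose T (bidualRestrict Y b) = bidualRestrict (θ ⁻¹' Y) (T b) := by
  ext ψ
  rw [Bidual.secondTranspose_apply]
  let F : Clopens K → Clopens K := fun C => ⟨θ ⁻¹' C, C.isClopen.preimage θ.continuous⟩
  have hF : Tendsto F (clopenNhds Y) (clopenNhds (θ ⁻¹' Y)) := by
    refine tendsto_clopenNhds_iff.2 ⟨?_, fun C hC => ?_⟩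
    · filter_upwards [clopenNhds_eventually_subset Y] with C hC using Set.preimage_mono hC
    · have hcl : IsClosed (θ '' (C : Set K)ᶜ) :=
        (C.isClopen.2.isClosed_compl.isCompact.image θ.continuous).isClosed
      filter_upwards [clopenNhds_eventually_subset_of_isOpen hY hcl.isOpen_compl (by
        rintro y hy ⟨x, hx, rfl⟩
        exact hx (hC hy))] with D hD x hx
      by_contra hxC
      exact hD hx ⟨x, hxC, rfl⟩
  refine tendsto_nhds_unique (tendsto_bidualRestrict Y b (ψ.comp T)) ?_
  refine ((tendsto_bidualRestrict (θ ⁻¹' Y) (T b) ψ).comp hF).congr fun C => ?_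
  simp only [Function.comp_apply, ContinuousLinearMap.comp_apply, hT]
  rfl

end ClopenLimits

/-! ### The Poisson transform and proximal pieces -/

namespace CompactAction

variable {Γ : Type u} [Group Γ] (A : CompactAction.{u, w} Γ)

theorem integrable_continuousMap (μ : Measure A.space) [IsFiniteMeasure μ] (f : C(A.space, ℂ)) :
    Integrable f μ :=
  BoundedContinuousFunction.integrable _ (BoundedContinuousFunction.mkOfCompact f)

/-- The function `f` moved by the action of `g`. -/
def translate (g : Γ) (f : C(A.space, ℂ)) : C(A.space, ℂ) :=
  f.comp ⟨fun y => g • y, continuous_const_smul g⟩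

/-- The function `g ↦ ∫ f d(g·η)` on `Γ`. -/
def orbitIntegral (f : C(A.space, ℂ)) (g : Γ) : ℂ := ∫ y, f (g • y) ∂A.η

theorem norm_orbitIntegral_le (f : C(A.space, ℂ)) (g : Γ) : ‖A.orbitIntegral f g‖ ≤ ‖f‖ := by
  have := norm_integral_le_of_norm_le_const (μ := A.η) (C := ‖f‖)
    (ae_of_all _ fun y => f.norm_coe_le_norm (g • y))
  simpa [orbitIntegral] using this

theorem integral_map_smul (f : C(A.space, ℂ)) (g : Γ) :
    ∫ x, f x ∂(A.η.map (fun y => g • y)) = A.orbitIntegral f g :=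
  integral_map (continuous_const_smul g).measurable.aemeasurable
    f.continuous.aestronglyMeasurable

/-- The Poisson transform: the continuous extension of `g ↦ ∫ f d(g·η)` to `ΔΓ`. -/
def poisson (f : C(A.space, ℂ)) : C(Ultrafilter Γ, ℂ) := ultrafilterExtend (A.orbitIntegral f)

theorem tendsto_poisson (f : C(A.space, ℂ)) (ω : Ultrafilter Γ) :
    Tendsto (A.orbitIntegral f) ω (𝓝 (A.poisson f ω)) :=
  tendsto_ultrafilterExtend (A.norm_orbitIntegral_le f) ω

theorem poisson_eq (f : C(A.space, ℂ)) {ω : Ultrafilter Γ} {z : ℂ}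
    (h : Tendsto (A.orbitIntegral f) ω (𝓝 z)) : A.poisson f ω = z :=
  tendsto_nhds_unique (A.tendsto_poisson f ω) h

theorem poisson_add (f f' : C(A.space, ℂ)) : A.poisson (f + f') = A.poisson f + A.poisson f' := by
  ext ω
  refine A.poisson_eq _ (((A.tendsto_poisson f ω).add (A.tendsto_poisson f' ω)).congr fun g => ?_)
  exact (integral_add (A.integrable_continuousMap A.η (A.translate g f))
    (A.integrable_continuousMap A.η (A.translate g f'))).symm

theorem poisson_smul (c : ℂ) (f : C(A.space, ℂ)) : A.poisson (c • f) = c • A.poisson f := by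
  ext ω
  refine A.poisson_eq _ (((A.tendsto_poisson f ω).const_mul c).congr fun g => ?_)
  exact (integral_const_mul c _).symm

theorem poisson_one : A.poisson 1 = 1 := by
  ext ω
  refine A.poisson_eq _ (tendsto_const_nhds.congr fun g => ?_)
  simp [orbitIntegral]

theorem poisson_nonneg {f : C(A.space, ℂ)} (hf : ∀ y, 0 ≤ f y) (ω : Ultrafilter Γ) :
    0 ≤ A.poisson f ω :=
  ge_of_tendsto (A.tendsto_poisson f ω)
    (Eventually.of_forall fun g => integral_nonneg fun y => hf (g • y))

theorem poisson_translate (g : Γ) (f : C(A.space, ℂ)) (ω : Ultrafilter Γ) :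
    A.poisson (A.translate g f) ω = A.poisson f (leftTranslate g ω) := by
  refine A.poisson_eq _ ?_
  refine (tendsto_map'_iff.1 (A.tendsto_poisson f (leftTranslate g ω))).congr fun x => ?_
  simp only [Function.comp_apply, orbitIntegral, mul_smul]
  rfl

/-- Both integrals in the definition converge along `ω`, so vanishing of the limit is an equality of
Poisson transforms. Closedness and bi-invariance of the piece follow from this form. -/
theorem mem_proximalPiece_iff {ω : Ultrafilter Γ} : ω ∈ A.proximalPiece ↔
    ∀ (h : Γ) (f : C(A.space, ℂ)), A.poisson f (rightTranslate h ω) = A.poisson f ω := by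
  have key : ∀ (h : Γ) (f : C(A.space, ℂ)), Tendsto (fun g : Γ =>
      (∫ x, f x ∂(A.η.map (fun y => (g * h) • y))) - ∫ x, f x ∂(A.η.map (fun y => g • y))) ω
      (𝓝 (A.poisson f (rightTranslate h ω) - A.poisson f ω)) := by
    intro h f
    simp only [integral_map_smul]
    exact (tendsto_map'_iff.1 (A.tendsto_poisson f (rightTranslate h ω))).sub
      (A.tendsto_poisson f ω)
  refine ⟨fun hω h f => sub_eq_zero.1 (tendsto_nhds_unique (key h f) (hω h f)), fun hω h f => ?_⟩
  have := key h f
  rwa [hω, sub_self] at this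

theorem isClosed_proximalPiece : IsClosed A.proximalPiece := by
  have : A.proximalPiece = ⋂ (h : Γ) (f : C(A.space, ℂ)),
      {ω | A.poisson f (rightTranslate h ω) = A.poisson f ω} := by
    ext ω
    simp only [mem_proximalPiece_iff, Set.mem_iInter, Set.mem_ofPred_eq]
  rw [this]
  exact isClosed_iInter fun h => isClosed_iInter fun f => isClosed_eq
    ((A.poisson f).continuous.comp (continuous_rightTranslate h)) (A.poisson f).continuous

theorem leftTranslate_mem_proximalPiece {ω : Ultrafilter Γ} (hω : ω ∈ A.proximalPiece) (g : Γ) :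
    leftTranslate g ω ∈ A.proximalPiece := by
  rw [mem_proximalPiece_iff] at hω ⊢
  intro h f
  rw [← leftTranslate_rightTranslate, ← poisson_translate, ← poisson_translate, hω]

theorem rightTranslate_mem_proximalPiece {ω : Ultrafilter Γ} (hω : ω ∈ A.proximalPiece) (g : Γ) :
    rightTranslate g ω ∈ A.proximalPiece := by
  rw [mem_proximalPiece_iff] at hω ⊢
  intro h f
  rw [rightTranslate_rightTranslate, hω, hω]

/-- A positive unital functional on `C(K)` which is invariant under the action gives an invariant
probability measure on `K`. -/
theorem hasInvariantProbability_of_functional (ν : C(A.space, ℂ) →ₗ[ℂ] ℂ)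
    (hν : IsPositiveFunctional ν) (h1 : ν 1 = 1) (hinv : ∀ g f, ν (A.translate g f) = ν f) :
    A.HasInvariantProbability := by
  obtain ⟨μ, hμ, hreg, hint⟩ := hν.exists_measure
  refine ⟨μ, ⟨?_⟩, hreg, fun g => ?_⟩
  · rw [hint] at h1
    have h2 : (μ.real Set.univ : ℂ) = 1 := by simpa using h1
    have h3 : μ.real Set.univ = 1 := by exact_mod_cast h2
    rwa [Measure.real, ENNReal.toReal_eq_one_iff] at h3
  · have hreg' : (μ.map (fun x : A.space => g • x)).Regular :=
      Measure.Regular.map (Homeomorph.smul g)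
    refine Measure.ext_of_integral_eq_on_compactlySupported fun f => ?_
    have h2 := hinv g f.toContinuousMap.toComplex
    rw [hint, hint] at h2
    rw [integral_map (continuous_const_smul g).measurable.aemeasurable
      (map_continuous f).aestronglyMeasurable]
    have h3 : ∫ x, ((f (g • x) : ℝ) : ℂ) ∂μ = ∫ x, ((f x : ℝ) : ℂ) ∂μ := h2
    rw [integral_complex_ofReal, integral_complex_ofReal] at h3
    exact_mod_cast h3

end CompactAction

/-! ### A covering by proximal pieces excludes invariant states on the bidual -/

namespace BoundaryPiece

variable {Γ : Type u} [Group Γ] (X : BoundaryPiece Γ)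

theorem bidualRestrict_mem {Y : Set X.carrier} (hY : IsClosed Y)
    (hinv : ∀ h, X.rightMap h ⁻¹' Y = Y) {b : C(X.carrier, ℂ)}
    (hb : ∀ h, ∀ ω ∈ Y, b (X.rightMap h ω) = b ω) :
    bidualRestrict Y b ∈ X.bidualRightInvariant := by
  intro h
  rw [secondTranspose_bidualRestrict hY (X.rightMap h) _ (fun _ => rfl), hinv]
  exact bidualRestrict_congr hY (hb h)

variable {X}

/-- If `s` is the square root of `b`, then the product of `b` with the indicator of `Y` is `m* m`,
where `m` is the product of `s` with that indicator. -/
theorem map_bidualRestrict_nonneg {φ : X.bidualRightInvariant →ₗ[ℂ] ℂ} (hφ : IsState φ)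
    {Y : Set X.carrier} (hY : IsClosed Y) (hinv : ∀ h, X.rightMap h ⁻¹' Y = Y)
    {b : C(X.carrier, ℂ)} (hb : ∀ h, ∀ ω ∈ Y, b (X.rightMap h ω) = b ω)
    (hb0 : ∀ ω, 0 ≤ b ω) (hmem : bidualRestrict Y b ∈ X.bidualRightInvariant) :
    0 ≤ φ ⟨bidualRestrict Y b, hmem⟩ := by
  obtain ⟨s, hs, hsb⟩ := b.exists_star_mul_self hb0
  have hsinv : ∀ h, ∀ ω ∈ Y, s (X.rightMap h ω) = s ω := fun h ω hω => hsb _ _ (hb h ω hω)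
  have h := hφ.nonneg ⟨bidualRestrict Y s, X.bidualRestrict_mem hY hinv hsinv⟩
  have heq : star (⟨bidualRestrict Y s, X.bidualRestrict_mem hY hinv hsinv⟩ :
      X.bidualRightInvariant) * ⟨bidualRestrict Y s, X.bidualRestrict_mem hY hinv hsinv⟩ =
      ⟨bidualRestrict Y b, hmem⟩ := by
    apply Subtype.ext
    change Bidual.arensMul (Bidual.bidualStar (bidualRestrict Y s)) (bidualRestrict Y s) = _
    rw [bidualStar_bidualRestrict, arensMul_bidualRestrict hY, hs]
  rwa [heq] at h

/-- If a state vanishes on finitely many invariant closed sets, then these do not cover `X`. -/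
theorem exists_map_bidualRestrict_ne_zero {φ : X.bidualRightInvariant →ₗ[ℂ] ℂ} (hφ : IsState φ)
    {ι : Type*} [Finite ι] (Y : ι → Set X.carrier) (hY : ∀ i, IsClosed (Y i))
    (hinv : ∀ i h, X.rightMap h ⁻¹' Y i = Y i) (hcover : ⋃ i, Y i = Set.univ) :
    ∃ i, φ ⟨bidualRestrict (Y i) 1,
      X.bidualRestrict_mem (hY i) (hinv i) fun _ _ _ => rfl⟩ ≠ 0 := by
  classical
  by_contra! hcon
  have := Fintype.ofFinite ι
  have key : ∀ s : Finset ι, ∃ hmem, IsClosed (⋃ i ∈ s, Y i) ∧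
      (∀ h, X.rightMap h ⁻¹' (⋃ i ∈ s, Y i) = ⋃ i ∈ s, Y i) ∧
      φ ⟨bidualRestrict (⋃ i ∈ s, Y i) 1, hmem⟩ = 0 := by
    intro s
    induction s using Finset.induction_on with
    | empty =>
      have h0 : bidualRestrict (⋃ i ∈ (∅ : Finset ι), Y i) (1 : C(X.carrier, ℂ)) = 0 := by
        refine bidualRestrict_eq_zero (by simp) (by simp)
      refine ⟨h0 ▸ zero_mem _, by simp, by simp, ?_⟩
      simp only [h0]
      exact map_zero φ
    | insert a s _ ih =>
      obtain ⟨hmem, hcl, hi, h0⟩ := ih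
      rw [Finset.set_biUnion_insert]
      have hcl' := (hY a).union hcl
      have hi' : ∀ h, X.rightMap h ⁻¹' (Y a ∪ ⋃ i ∈ s, Y i) = Y a ∪ ⋃ i ∈ s, Y i := fun h => by
        rw [Set.preimage_union, hinv, hi]
      have hcl'' := (hY a).inter hcl
      have hi'' : ∀ h, X.rightMap h ⁻¹' (Y a ∩ ⋃ i ∈ s, Y i) = Y a ∩ ⋃ i ∈ s, Y i := fun h => by
        rw [Set.preimage_inter, hinv, hi]
      have hone : ∀ Z : Set X.carrier, ∀ h, ∀ ω ∈ Z,
        (1 : C(X.carrier, ℂ)) (X.rightMap h ω) = (1 : C(X.carrier, ℂ)) ω := fun _ _ _ _ => rfl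
      have hm' := X.bidualRestrict_mem hcl' hi' (hone _)
      have hm'' := X.bidualRestrict_mem hcl'' hi'' (hone _)
      refine ⟨hm', hcl', hi', ?_⟩
      have hp' := map_bidualRestrict_nonneg hφ hcl' hi' (hone _) (fun _ => zero_le_one) hm'
      have hp'' := map_bidualRestrict_nonneg hφ hcl'' hi'' (hone _) (fun _ => zero_le_one) hm''
      -- By inclusion–exclusion the values on the union and the intersection add up to `0`; both are
      -- nonnegative, so both vanish.
      have hsum : φ ⟨_, hm'⟩ + φ ⟨_, hm''⟩ = 0 := by
        have e := congrArg₂ (· + ·) (hcon a) h0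
        simp only [add_zero] at e
        rw [← map_add] at e ⊢
        rw [← e]
        exact congrArg φ (Subtype.ext (bidualRestrict_union_add_inter (hY a) hcl 1))
      exact ((add_eq_zero_iff_of_nonneg hp' hp'').1 hsum).1
  obtain ⟨hmem, -, -, h0⟩ := key Finset.univ
  have huniv : ⋃ i ∈ Finset.univ, Y i = Set.univ := by simpa using hcover
  have h1 : (⟨bidualRestrict (⋃ i ∈ Finset.univ, Y i) 1, hmem⟩ : X.bidualRightInvariant) = 1 := by
    apply Subtype.ext
    change bidualRestrict (⋃ i ∈ Finset.univ, Y i) 1 = _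
    rw [huniv, bidualRestrict_univ]
    rfl
  rw [h1, hφ.map_one] at h0
  exact one_ne_zero h0

theorem not_hasInvariantStateBidual_of_covered (hX : CoveredByProximal.{u, w} X) :
    ¬ X.HasInvariantStateBidual := by
  rintro ⟨φ, hφ, hφinv⟩
  obtain ⟨k, A, hA, hcov⟩ := hX
  let Y : Fin k → Set X.carrier := fun i => Subtype.val ⁻¹' (A i).proximalPiece
  have hY : ∀ i, IsClosed (Y i) := fun i =>
    (A i).isClosed_proximalPiece.preimage continuous_subtype_val
  have hr : ∀ i h, X.rightMap h ⁻¹' Y i = Y i := fun i h => by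
    ext ω
    refine ⟨fun hω => ?_, fun hω => (A i).rightTranslate_mem_proximalPiece hω h⟩
    have := (A i).rightTranslate_mem_proximalPiece hω h⁻¹
    change rightTranslate h⁻¹ (rightTranslate h ω.1) ∈ _ at this
    rwa [rightTranslate_rightTranslate, mul_inv_cancel, rightTranslate_one] at this
  have hl : ∀ i g, X.leftMap g ⁻¹' Y i = Y i := fun i g => by
    ext ω
    refine ⟨fun hω => ?_, fun hω => (A i).leftTranslate_mem_proximalPiece hω g⟩
    have := (A i).leftTranslate_mem_proximalPiece hω g⁻¹
    change leftTranslate g⁻¹ (leftTranslate g ω.1) ∈ _ at this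
    rwa [leftTranslate_leftTranslate, inv_mul_cancel, leftTranslate_one] at this
  obtain ⟨i, hi⟩ := exists_map_bidualRestrict_ne_zero hφ Y hY hr (by
    refine Set.eq_univ_of_forall fun ω => ?_
    simpa [Y] using hcov ω.2)
  refine hA i ?_
  let b : C((A i).space, ℂ) → C(X.carrier, ℂ) := fun f => ((A i).poisson f).restrict X.carrier
  have hb : ∀ f h, ∀ ω ∈ Y i, b f (X.rightMap h ω) = b f ω := fun f h ω hω =>
    (A i).mem_proximalPiece_iff.1 hω h f
  let e : C((A i).space, ℂ) → X.bidualRightInvariant := fun f =>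
    ⟨bidualRestrict (Y i) (b f), X.bidualRestrict_mem (hY i) (hr i) (hb f)⟩
  have he1 : e 1 = ⟨bidualRestrict (Y i) 1, X.bidualRestrict_mem (hY i) (hr i) fun _ _ _ => rfl⟩ := by
    apply Subtype.ext
    change bidualRestrict (Y i) (((A i).poisson 1).restrict X.carrier) = bidualRestrict (Y i) 1
    rw [(A i).poisson_one]
    rfl
  have hadd : ∀ f f', e (f + f') = e f + e f' := fun f f' => by
    apply Subtype.ext
    change bidualRestrict (Y i) (((A i).poisson (f + f')).restrict X.carrier) =
      bidualRestrict (Y i) (b f) + bidualRestrict (Y i) (b f')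
    rw [(A i).poisson_add, ← bidualRestrict_add]
    rfl
  have hsmul : ∀ (c : ℂ) f, e (c • f) = c • e f := fun c f => by
    apply Subtype.ext
    change bidualRestrict (Y i) (((A i).poisson (c • f)).restrict X.carrier) =
      c • bidualRestrict (Y i) (b f)
    rw [(A i).poisson_smul, ← bidualRestrict_smul]
    rfl
  have hpos : ∀ f : C((A i).space, ℂ), (∀ y, 0 ≤ f y) → 0 ≤ φ (e f) := fun f hf =>
    map_bidualRestrict_nonneg hφ (hY i) (hr i) (hb f) (fun ω => (A i).poisson_nonneg hf ω) _
  have hinv : ∀ g f, φ (e ((A i).translate g f)) = φ (e f) := fun g f => by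
    -- The operator `leftAct g⁻¹` evaluates at `g ω`, which is what `poisson_translate` requires.
    rw [← hφinv g⁻¹ (e f)]
    congr 1
    apply Subtype.ext
    change bidualRestrict (Y i) (b ((A i).translate g f)) =
      Bidual.secondTranspose (X.leftAct g⁻¹) (bidualRestrict (Y i) (b f))
    rw [secondTranspose_bidualRestrict (hY i) (X.leftMap g⁻¹⁻¹) _ (fun _ => rfl), hl]
    congr 1
    ext ω
    change (A i).poisson ((A i).translate g f) ω = (A i).poisson f (leftTranslate g⁻¹⁻¹ ω)
    rw [inv_inv, (A i).poisson_translate]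
  rw [← he1] at hi
  have h1 : 0 ≤ φ (e 1) := hpos 1 fun _ => zero_le_one
  refine (A i).hasInvariantProbability_of_functional
    { toFun := fun f => (φ (e 1))⁻¹ * φ (e f)
      map_add' := fun f f' => by rw [hadd, map_add, mul_add]
      map_smul' := fun c f => by
        rw [hsmul, map_smul, smul_eq_mul, RingHom.id_apply, smul_eq_mul]; ring }
    (fun f hf => mul_nonneg (inv_nonneg.2 h1) (hpos f hf)) (inv_mul_cancel₀ hi)
    (fun g f => congrArg ((φ (e 1))⁻¹ * ·) (hinv g f))

end BoundaryPiece

/-! ### Coboundaries in the right-invariant part of the bidual -/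

namespace BoundaryPiece

set_option maxSynthPendingDepth 3

variable {Γ : Type u} [Group Γ] (X : BoundaryPiece Γ)

/-- The left action of `Γ` on `(C(X)**)^{Γ_r}`, as a linear map. -/
def leftActBidualLinear (g : Γ) : X.bidualRightInvariant →ₗ[ℂ] X.bidualRightInvariant where
  toFun := X.leftActBidualInvariant g
  map_add' _ _ := rfl
  map_smul' _ _ := rfl

/-- The map `(m_g)_g ↦ ∑ (m_g - g·m_g)`. -/
def bidualCoboundary : (Γ →₀ X.bidualRightInvariant) →ₗ[ℂ] Bidual C(X.carrier, ℂ) :=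
  Finsupp.lsum ℂ fun g : Γ => X.bidualRightInvariant.subtype ∘ₗ
    ((LinearMap.id : X.bidualRightInvariant →ₗ[ℂ] X.bidualRightInvariant) -
      X.leftActBidualLinear g)

theorem bidualCoboundary_single (g : Γ) (m : X.bidualRightInvariant) :
    X.bidualCoboundary (Finsupp.single g m) = m.1 - (X.leftActBidualInvariant g m).1 := by
  rw [bidualCoboundary, Finsupp.lsum_single]
  rfl

theorem bidualCoboundary_apply (m : Γ →₀ X.bidualRightInvariant) :
    X.bidualCoboundary m =
      ∑ j : m.support, ((m j).1 - (X.leftActBidualInvariant j (m j)).1) := by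
  rw [bidualCoboundary, Finsupp.lsum_apply, Finsupp.sum, ← Finset.sum_coe_sort]
  rfl

end BoundaryPiece

/-! ### A Hahn–Banach alternative for subspaces of the bidual -/

section Accretive

set_option maxSynthPendingDepth 3

variable {K : Type*} [TopologicalSpace K] [CompactSpace K]

/-- The elements of `C(K)**` with nonnegative real part. -/
def bidualAccretive (K : Type*) [TopologicalSpace K] [CompactSpace K] : Set (Bidual C(K, ℂ)) :=
  {m | ∀ ν : StrongDual ℂ C(K, ℂ), IsPositiveFunctional ν.toLinearMap → 0 ≤ (m ν).re}

theorem convex_bidualAccretive : Convex ℝ (bidualAccretive K) := by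
  intro m hm n hn a b ha hb _ ν hν
  have : ((a • m + b • n) ν).re = a * (m ν).re + b * (n ν).re := by simp
  rw [this]
  exact add_nonneg (mul_nonneg ha (hm ν hν)) (mul_nonneg hb (hn ν hν))

theorem smul_mem_bidualAccretive {t : ℝ} (ht : 0 ≤ t) {m : Bidual C(K, ℂ)}
    (hm : m ∈ bidualAccretive K) : (t : ℂ) • m ∈ bidualAccretive K := by
  intro ν hν
  have : (((t : ℂ) • m) ν).re = t * (m ν).re := by simp
  rw [this]
  exact mul_nonneg ht (hm ν hν)

open scoped Pointwise in
/-- A subspace of `C(K)**` either contains an element whose real part is bounded below by a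
positive constant, or is annihilated by a nonzero positive functional. -/
theorem exists_positive_annihilator_or [T2Space K] (N : Submodule ℂ (Bidual C(K, ℂ))) :
    (∃ n ∈ N, ∃ c : ℝ, 0 < c ∧ ∀ ν : StrongDual ℂ C(K, ℂ), IsPositiveFunctional ν.toLinearMap →
      c * (ν 1).re ≤ (n ν).re) ∨
    ∃ χ : StrongDual ℂ (Bidual C(K, ℂ)), (∀ n ∈ N, χ n = 0) ∧
      χ (NormedSpace.inclusionInDoubleDual ℂ C(K, ℂ) 1) ≠ 0 ∧
      ∀ m : Bidual C(K, ℂ), (∀ ν : StrongDual ℂ C(K, ℂ),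
        IsPositiveFunctional ν.toLinearMap → 0 ≤ m ν) → 0 ≤ χ m := by
  let e : Bidual C(K, ℂ) := NormedSpace.inclusionInDoubleDual ℂ C(K, ℂ) 1
  -- If `N` misses this open convex set, separation gives the functional. If it meets it in `b + p`,
  -- the real part is at least `1 - ‖b - e‖`.
  by_cases hdisj : Disjoint (Metric.ball e 1 + bidualAccretive K) (N : Set (Bidual C(K, ℂ)))
  · right
    obtain ⟨ℓ, r, h1, h2⟩ := RCLike.geometric_hahn_banach_open (𝕜 := ℂ)
      ((convex_ball e 1).add convex_bidualAccretive)
      (Metric.isOpen_ball.add_right) (N.restrictScalars ℝ).convex hdisj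
    have hr : r ≤ 0 := by
      have := h2 0 N.zero_mem
      simpa using this
    have hℓt : ∀ n ∈ N, ℓ n = 0 := by
      intro n hn
      by_contra hne
      have hpos : 0 < ‖ℓ n‖ ^ 2 := by positivity
      obtain ⟨k, hk⟩ := exists_nat_gt (-r / ‖ℓ n‖ ^ 2)
      rw [div_lt_iff₀ hpos] at hk
      -- On the complex subspace `N` the real part of `ℓ` is bounded below by `r`; a multiple
      -- turning `ℓ n` into a large negative number violates this.
      have h3 := h2 _ (N.smul_mem (-((k : ℂ) * star (ℓ n))) hn)
      rw [map_smul, smul_eq_mul] at h3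
      have h4 : -((k : ℂ) * star (ℓ n)) * ℓ n = ((-(k * ‖ℓ n‖ ^ 2) : ℝ) : ℂ) := by
        have : star (ℓ n) * ℓ n = (‖ℓ n‖ : ℂ) ^ 2 := Complex.conj_mul' _
        rw [neg_mul, mul_assoc, this]
        push_cast
        ring
      rw [h4] at h3
      change r ≤ ((-(k * ‖ℓ n‖ ^ 2) : ℝ) : ℂ).re at h3
      rw [Complex.ofReal_re] at h3
      linarith
    have hs : ∀ p ∈ bidualAccretive K, (ℓ (e + p)).re < 0 := fun p hp =>
      (h1 _ (Set.add_mem_add (Metric.mem_ball_self one_pos) hp)).trans_le hr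
    have hacc : ∀ p ∈ bidualAccretive K, (ℓ p).re ≤ 0 := by
      intro p hp
      by_contra! hneg
      obtain ⟨n, hn⟩ := exists_nat_gt (-(ℓ e).re / (ℓ p).re)
      rw [div_lt_iff₀ hneg] at hn
      have h3 := hs _ (smul_mem_bidualAccretive (Nat.cast_nonneg n) hp)
      rw [map_add, map_smul] at h3
      simp at h3
      linarith
    refine ⟨-ℓ, fun n hn => by simp [hℓt n hn], fun h0 => ?_, fun m hm => ?_⟩
    · have h3 := hs 0 (fun ν _ => le_rfl)
      have h4 : ℓ e = 0 := neg_eq_zero.1 h0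
      rw [add_zero, h4] at h3
      exact lt_irrefl _ h3
    · have h3 := hacc m fun ν hν => (Complex.le_def.1 (hm ν hν)).1
      have him : ∀ ν : StrongDual ℂ C(K, ℂ),
        IsPositiveFunctional ν.toLinearMap → (m ν).im = 0 := fun ν hν =>
          (Complex.le_def.1 (hm ν hν)).2.symm
      -- For `m` real on positive functionals, `±i m` both have real part `0` there, which forces `ℓ
      -- m` to be real.
      have h4 := hacc (Complex.I • m) fun ν hν => by
        change 0 ≤ (Complex.I • m ν).re
        simp [him ν hν]
      have h5 := hacc ((-Complex.I) • m) fun ν hν => by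
        change 0 ≤ ((-Complex.I) • m ν).re
        simp [him ν hν]
      rw [map_smul] at h4 h5
      simp at h4 h5
      change 0 ≤ -ℓ m
      refine Complex.le_def.2 ⟨by simpa using h3, ?_⟩
      simp
      linarith
  · left
    obtain ⟨_, ⟨b, hb, p, hp, rfl⟩, hn⟩ := Set.not_disjoint_iff.1 hdisj
    have hb' : ‖b - e‖ < 1 := by rwa [← dist_eq_norm]
    refine ⟨b + p, hn, 1 - ‖b - e‖, by linarith, fun ν hν => ?_⟩
    have h1 : ((b + p) ν) = ν 1 + (b - e) ν + p ν := by
      change b ν + p ν = ν 1 + (b ν - ν 1) + p ν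
      ring
    have hν1 : 0 ≤ (ν 1).re := (Complex.le_def.1 (hν 1 fun _ => zero_le_one)).1
    have h2 : ‖(b - e) ν‖ ≤ ‖b - e‖ * (ν 1).re := by
      refine ((b - e).le_opNorm ν).trans (mul_le_mul_of_nonneg_left ?_ (norm_nonneg _))
      exact ν.opNorm_le_bound hν1 hν.norm_apply_le
    have h3 := (abs_le.1 ((Complex.abs_re_le_norm _).trans h2)).1
    have h4 := hp ν hν
    rw [h1, Complex.add_re, Complex.add_re]
    linarith

end Accretive

/-! ### Uniformly bounded, nearly invariant functions -/

namespace BoundaryPiece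

set_option maxSynthPendingDepth 3

variable {Γ : Type u} [Group Γ] {X : BoundaryPiece Γ}

/-- Otherwise a positive functional annihilates all coboundaries, and its normalized restriction is
an invariant state, since `m* m` is positive. -/
theorem exists_bidualCoboundary_of_not_hasInvariantState (h : ¬ X.HasInvariantStateBidual) :
    ∃ (m : Γ →₀ X.bidualRightInvariant) (c : ℝ), 0 < c ∧
      ∀ ν : StrongDual ℂ C(X.carrier, ℂ), IsPositiveFunctional ν.toLinearMap →
        c * (ν 1).re ≤ (X.bidualCoboundary m ν).re := by
  rcases exists_positive_annihilator_or (LinearMap.range X.bidualCoboundary) with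
    ⟨_, ⟨m, rfl⟩, c, hc, hm⟩ | ⟨χ, h0, h1, hpos⟩
  · exact ⟨m, c, hc, hm⟩
  · have hone : 0 ≤ χ (NormedSpace.inclusionInDoubleDual ℂ C(X.carrier, ℂ) 1) :=
      hpos _ fun ν hν => hν 1 fun _ => zero_le_one
    refine absurd ⟨(χ (NormedSpace.inclusionInDoubleDual ℂ C(X.carrier, ℂ) 1))⁻¹ •
      (χ.toLinearMap ∘ₗ X.bidualRightInvariant.subtype), ⟨fun m => ?_, inv_mul_cancel₀ h1⟩,
      fun g m => ?_⟩ h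
    · refine mul_nonneg (inv_nonneg.2 hone) (hpos _ fun ν hν => ?_)
      exact Bidual.arensMul_star_self_nonneg ν hν m.1
    · have h3 := h0 _ ⟨Finsupp.single g m, rfl⟩
      rw [bidualCoboundary_single, map_sub, sub_eq_zero] at h3
      exact congrArg ((χ (NormedSpace.inclusionInDoubleDual ℂ C(X.carrier, ℂ) 1))⁻¹ * ·) h3.symm

/-- The data `S`, `M` and `c` do not depend on `F` and `ε`; the averaging argument needs this
uniformity. -/
theorem exists_approx_of_not_hasInvariantStateBidual (h : ¬ X.HasInvariantStateBidual) :
    ∃ (S : Finset Γ) (M c : ℝ), 0 < c ∧ 0 ≤ M ∧ ∀ (F : Finset Γ) (ε : ℝ), 0 < ε →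
      ∃ f : S → C(X.carrier, ℂ), (∀ j, ‖f j‖ ≤ M) ∧
        (∀ ω, c - ε < (∑ j, (f j ω - X.leftAct j (f j) ω)).re) ∧
        ∀ j, ∀ k ∈ F, ‖f j - X.rightAct k (f j)‖ < ε := by
  classical
  obtain ⟨m, c, hc, hm⟩ := exists_bidualCoboundary_of_not_hasInvariantState h
  have hle : ∀ j : m.support, ‖(m j).1‖ ≤ ∑ i : m.support, ‖(m i).1‖ := fun j =>
    Finset.single_le_sum (f := fun i : m.support => ‖(m i).1‖) (fun i _ => norm_nonneg (m i).1)
      (Finset.mem_univ j)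
  refine ⟨m.support, ∑ j : m.support, ‖(m j).1‖, c, hc,
    Finset.sum_nonneg fun i _ => norm_nonneg (m i).1, fun F ε hε => ?_⟩
  obtain ⟨f, h1, h2, h3⟩ := exists_approx_of_bidual (ι := m.support) (κ := F)
    (fun j => X.leftAct j) (fun k => X.rightAct k) (fun j => (m j).1) (fun j k => (m j).2 k) (c := c)
    (fun ν hν => by
      refine (hm ν hν).trans (le_of_eq (congrArg Complex.re ?_))
      rw [bidualCoboundary_apply, sum_apply]
      rfl)
    (M := ∑ j : m.support, ‖(m j).1‖)
    (Finset.sum_nonneg fun i _ => norm_nonneg (m i).1) hle hε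
  exact ⟨f, h1, h2, fun j k hk => h3 j ⟨k, hk⟩⟩

end BoundaryPiece

/-! ### Cesàro means over windows of varying length -/

section Cesaro

/-- The average of the first `a` terms of a sequence. -/
def cesaroMean (a : ℕ) (x : ℕ → ℝ) : ℝ := (a : ℝ)⁻¹ * ∑ n ∈ Finset.range a, x n

theorem cesaroMean_mono {a : ℕ} {x y : ℕ → ℝ} (h : ∀ n < a, x n ≤ y n) :
    cesaroMean a x ≤ cesaroMean a y :=
  mul_le_mul_of_nonneg_left (Finset.sum_le_sum fun n hn => h n (Finset.mem_range.1 hn))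
    (inv_nonneg.2 (Nat.cast_nonneg a))

theorem cesaroMean_const {a : ℕ} (ha : 0 < a) (M : ℝ) : cesaroMean a (fun _ => M) = M := by
  have : (a : ℝ) ≠ 0 := by positivity
  rw [cesaroMean, Finset.sum_const, Finset.card_range, nsmul_eq_mul]
  field_simp

theorem cesaroMean_sub (a : ℕ) (x y : ℕ → ℝ) :
    cesaroMean a (fun n => x n - y n) = cesaroMean a x - cesaroMean a y := by
  rw [cesaroMean, Finset.sum_sub_distrib, mul_sub]
  rfl

theorem cesaroMean_sum {ι : Type*} (s : Finset ι) (a : ℕ) (x : ι → ℕ → ℝ) :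
    cesaroMean a (fun n => ∑ i ∈ s, x i n) = ∑ i ∈ s, cesaroMean a (x i) := by
  simp only [cesaroMean]
  rw [Finset.sum_comm, Finset.mul_sum]

theorem abs_cesaroMean_le (a : ℕ) (x : ℕ → ℝ) :
    |cesaroMean a x| ≤ cesaroMean a (fun n => |x n|) := by
  rw [cesaroMean, abs_mul, abs_of_nonneg (inv_nonneg.2 (Nat.cast_nonneg a))]
  exact mul_le_mul_of_nonneg_left (Finset.abs_sum_le_sum_abs _ _)
    (inv_nonneg.2 (Nat.cast_nonneg a))

theorem abs_cesaroMean_le_of_le {M : ℝ} (hM : 0 ≤ M) {x : ℕ → ℝ} (hx : ∀ n, |x n| ≤ M) (a : ℕ) :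
    |cesaroMean a x| ≤ M := by
  rcases Nat.eq_zero_or_pos a with rfl | ha
  · simpa [cesaroMean] using hM
  · exact (abs_cesaroMean_le a x).trans
      ((cesaroMean_mono fun n _ => hx n).trans (cesaroMean_const ha M).le)

theorem abs_cesaroMean_succ_sub_le {M : ℝ} (hM : 0 ≤ M) {x : ℕ → ℝ} (hx : ∀ n, |x n| ≤ M) (b : ℕ) :
    |cesaroMean (b + 1) x - cesaroMean b x| ≤ 2 * M / (b + 1) := by
  have hb : (0 : ℝ) < b + 1 := by positivity
  have h : cesaroMean (b + 1) x - cesaroMean b x = (x b - cesaroMean b x) / (b + 1) := by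
    rcases Nat.eq_zero_or_pos b with rfl | hb0
    -- The empty mean is `0`, as the inverse of `0` is `0`, so the formula persists.
    · simp [cesaroMean]
    · have : (b : ℝ) ≠ 0 := by positivity
      rw [cesaroMean, cesaroMean, Finset.sum_range_succ]
      push_cast
      field_simp
      ring
  rw [h, abs_div, abs_of_pos hb]
  refine div_le_div_of_nonneg_right ?_ hb.le
  have h1 := hx b
  have h2 := abs_cesaroMean_le_of_le hM hx b
  linarith [abs_sub (x b) (cesaroMean b x)]

/-- Changing the window length by at most one costs `2 * M / a`, which is negligible once the window
is long. -/
theorem abs_cesaroMean_sub_le {M : ℝ} (hM : 0 ≤ M) {x : ℕ → ℝ} (hx : ∀ n, |x n| ≤ M) {a b : ℕ}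
    (ha : 0 < a) (hab : a ≤ b + 1) (hba : b ≤ a + 1) :
    |cesaroMean b x - cesaroMean a x| ≤ 2 * M / a := by
  have ha' : (0 : ℝ) < a := by positivity
  rcases (by omega : b = a ∨ b = a + 1 ∨ a = b + 1) with rfl | rfl | rfl
  · rw [sub_self, abs_zero]; positivity
  · refine (abs_cesaroMean_succ_sub_le hM hx a).trans ?_
    gcongr
    linarith
  · rw [abs_sub_comm]
    refine (abs_cesaroMean_succ_sub_le hM hx b).trans ?_
    push_cast
    exact le_rfl

end Cesaro

/-! ### Averaging to exactly right-invariant functions -/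

namespace BoundaryPiece

variable {Γ : Type u} [Group Γ] (X : BoundaryPiece Γ)

/-- The subsets of `Γ` whose closure in `ΔΓ` is disjoint from `X`. -/
def Negligible (S : Set Γ) : Prop := ∀ ω ∈ X.carrier, S ∉ ω

variable {X}

theorem Negligible.union {S T : Set Γ} (hS : X.Negligible S) (hT : X.Negligible T) :
    X.Negligible (S ∪ T) := fun ω hω h =>
  (Ultrafilter.union_mem_iff.1 h).elim (hS ω hω) (hT ω hω)

theorem Negligible.biUnion {ι : Type*} {s : Finset ι} {S : ι → Set Γ}
    (h : ∀ i ∈ s, X.Negligible (S i)) : X.Negligible (⋃ i ∈ s, S i) := fun ω hω hmem => by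
  obtain ⟨i, hi, hSi⟩ := (Ultrafilter.finite_biUnion_mem_iff s.finite_toSet).1 hmem
  exact h i hi ω hω hSi

theorem negligible_singleton (x : Γ) : X.Negligible {x} := fun _ hω h =>
  X.subset_boundary hω ⟨x, (Ultrafilter.coe_le_coe.1 (le_pure_iff.2 h)).symm⟩

theorem Negligible.preimage_mul_right {S : Set Γ} (hS : X.Negligible S) (h : Γ) :
    X.Negligible ((fun x => x * h) ⁻¹' S) := fun ω hω hmem => hS _ (X.right_mem h ω hω) hmem

theorem Negligible.preimage_mul_left {S : Set Γ} (hS : X.Negligible S) (h : Γ) :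
    X.Negligible ((fun x => h * x) ⁻¹' S) := fun ω hω hmem => hS _ (X.left_mem h ω hω) hmem

/-- A function on `Γ` tending to infinity at `X`, dominating a given sequence of negligible sets,
which varies by at most one under translations. -/
theorem exists_length (e : ℕ → Γ) (he : Function.Surjective e) (T : ℕ → Set Γ)
    (hT : ∀ n, X.Negligible (T n)) : ∃ l : Γ → ℕ,
      (∀ ω ∈ X.carrier, Tendsto l ω atTop) ∧ (∀ n x, n < l x → x ∉ T n) ∧
      ∀ h, ∃ N, ∀ x, l (x * h) ≤ max (l x) N + 1 ∧ l (h * x) ≤ max (l x) N + 1 := by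
  classical
  -- The next set absorbs `T (n + 1)`, the element `e n`, and the left and right translates of `S`
  -- by `e 0, …, e n`. The length of `x` is the first stage containing `x`, so translation by `e k`
  -- raises it by at most one beyond stage `k`.
  let step : ℕ → Set Γ → Set Γ := fun n S => S ∪ (T (n + 1) ∪ ({e n} ∪
    ⋃ k ∈ Finset.range (n + 1),
      ((fun x => x * (e k)⁻¹) ⁻¹' S ∪ (fun x => (e k)⁻¹ * x) ⁻¹' S)))
  obtain ⟨S, hS0, hS⟩ : ∃ S : ℕ → Set Γ, S 0 = T 0 ∧ ∀ n, S (n + 1) = step n (S n) :=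
    ⟨fun n => Nat.rec (T 0) step n, rfl, fun _ => rfl⟩
  have hSstep : ∀ n x, x ∈ step n (S n) → x ∈ S (n + 1) := fun n x hx => by rwa [hS]
  have hneg : ∀ n, X.Negligible (S n) := by
    intro n
    induction n with
    | zero => exact hS0 ▸ hT 0
    | succ n ih =>
      rw [hS]
      exact ih.union ((hT _).union ((negligible_singleton _).union (Negligible.biUnion fun k _ =>
        (ih.preimage_mul_right _).union (ih.preimage_mul_left _))))
  have hmono : Monotone S := monotone_nat_of_le_succ fun n x hx =>
    hSstep n x (Or.inl hx)
  have hTS : ∀ n, T n ⊆ S n := fun n => by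
    cases n with
    | zero => exact hS0.ge
    | succ n => exact fun x hx => hSstep n x (Or.inr (Or.inl hx))
  have hex : ∀ x, ∃ n, x ∈ S n := fun x => by
    obtain ⟨n, rfl⟩ := he x
    exact ⟨n + 1, hSstep n _ (Or.inr (Or.inr (Or.inl rfl)))⟩
  have hle : ∀ (x : Γ) (n : ℕ), Nat.find (hex x) ≤ n ↔ x ∈ S n := fun x n =>
    ⟨fun h => hmono h (Nat.find_spec (hex x)), Nat.find_min' (hex x)⟩
  refine ⟨fun x => Nat.find (hex x), fun ω hω => ?_, fun n x hn hx => ?_, fun h => ?_⟩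
  · refine tendsto_atTop.2 fun n => ?_
    refine mem_of_superset (Ultrafilter.compl_mem_iff_notMem.2 (hneg n ω hω)) fun x hx => ?_
    by_contra hlt
    exact hx ((hle x n).1 (not_le.1 hlt).le)
  · exact absurd ((hle x n).2 (hTS n hx)) (not_le.2 hn)
  · obtain ⟨k, rfl⟩ := he h
    refine ⟨k, fun x => ?_⟩
    have hx : x ∈ S (max (Nat.find (hex x)) k) := (hle x _).1 (le_max_left _ _)
    have hk : k ∈ Finset.range (max (Nat.find (hex x)) k + 1) :=
      Finset.mem_range.2 (Nat.lt_succ_of_le (le_max_right _ _))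
    refine ⟨(hle _ _).2 (hSstep _ _ (Or.inr (Or.inr (Or.inr (Set.mem_biUnion hk (Or.inl ?_)))))),
      (hle _ _).2 (hSstep _ _ (Or.inr (Or.inr (Or.inr (Set.mem_biUnion hk (Or.inr ?_))))))⟩
    · change x * e k * (e k)⁻¹ ∈ S (max (Nat.find (hex x)) k)
      rwa [mul_inv_cancel_right]
    · change (e k)⁻¹ * (e k * x) ∈ S (max (Nat.find (hex x)) k)
      rwa [inv_mul_cancel_left]

theorem exists_real_extension (f : C(X.carrier, ℂ)) {M : ℝ} (hf : ‖f‖ ≤ M) :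
    ∃ G : C(Ultrafilter Γ, ℝ), (∀ σ, |G σ| ≤ M) ∧ ∀ ω : X.carrier, G ω = (f ω).re := by
  obtain ⟨g, hg1, hg2⟩ := BoundedContinuousFunction.exists_norm_eq_domRestrict_eq_of_closed
    (BoundedContinuousFunction.mkOfCompact f.rePart) X.isClosed'
  refine ⟨g.toContinuousMap, fun σ => ?_, fun ω => DFunLike.congr_fun hg2 ω⟩
  refine (g.norm_coe_le_norm σ).trans (hg1.le.trans (le_trans ?_ hf))
  refine (BoundedContinuousFunction.norm_le (norm_nonneg f)).2 fun ω => ?_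
  exact (Complex.abs_re_le_norm _).trans (f.norm_coe_le_norm ω)

theorem norm_rightAct_sub_apply (f : C(X.carrier, ℂ)) (h : Γ) {ε : ℝ}
    (hf : ‖f - X.rightAct h f‖ < ε) (ω : X.carrier) :
    |(f (X.rightMap h ω)).re - (f ω).re| < ε := by
  rw [abs_sub_comm, ← Complex.sub_re]
  exact (Complex.abs_re_le_norm _).trans_lt
    (((f - X.rightAct h f).norm_coe_le_norm ω).trans_lt hf)

/-- The approximately right-invariant functions can be chosen on `Γ`, with the estimates valid off
negligible sets. -/
theorem exists_approx_sequence {S : Finset Γ} {M c : ℝ} (hc : 0 < c) (e : ℕ → Γ)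
    (h : ∀ (F : Finset Γ) (ε : ℝ), 0 < ε →
      ∃ f : S → C(X.carrier, ℂ), (∀ j, ‖f j‖ ≤ M) ∧
        (∀ ω, c - ε < (∑ j, (f j ω - X.leftAct j (f j) ω)).re) ∧
        ∀ j, ∀ k ∈ F, ‖f j - X.rightAct k (f j)‖ < ε) :
    ∃ (G : S → ℕ → Γ → ℝ) (T : ℕ → Set Γ), (∀ j n x, |G j n x| ≤ M) ∧
      (∀ n, X.Negligible (T n)) ∧
      ∀ n, ∀ x ∉ T n, c / 2 < ∑ j, (G j n x - G j n ((j : Γ)⁻¹ * x)) ∧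
        ∀ j, ∀ k ≤ n, |G j n (x * e k) - G j n x| < 1 / ((n : ℝ) + 1) := by
  classical
  have key : ∀ n : ℕ, ∃ G : S → Γ → ℝ, (∀ j x, |G j x| ≤ M) ∧
      X.Negligible {x | ¬ (c / 2 < ∑ j, (G j x - G j ((j : Γ)⁻¹ * x)) ∧
        ∀ j, ∀ k ≤ n, |G j (x * e k) - G j x| < 1 / ((n : ℝ) + 1))} := by
    intro n
    -- The cap `c / 2` keeps the lower bound `c - ε` at least `c / 2`. The strict inequalities at
    -- each `ω` in `X` then hold on a set in `ω`, so the exceptional set is negligible.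
    obtain ⟨f, h1, h2, h3⟩ := h ((Finset.range (n + 1)).image e) (min (c / 2) (1 / ((n : ℝ) + 1)))
      (by positivity)
    choose G hG1 hG2 using fun j => exists_real_extension (f j) (h1 j)
    refine ⟨fun j x => G j (pure x), fun j x => hG1 j _, fun ω hω => ?_⟩
    have hev1 : ∀ᶠ x in (ω : Filter Γ),
        c / 2 < ∑ j, (G j (pure x) - G j (pure ((j : Γ)⁻¹ * x))) := by
      have ht : Tendsto (fun x => ∑ j, (G j (pure x) - G j (pure ((j : Γ)⁻¹ * x)))) ω
          (𝓝 (∑ j : S, (G j ω - G j (leftTranslate (j : Γ)⁻¹ ω)))) := by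
        refine tendsto_finsetSum _ fun j _ => (tendsto_apply_pure (G j).continuous ω).sub ?_
        have := tendsto_apply_pure ((G j).continuous.comp (continuous_leftTranslate (j : Γ)⁻¹)) ω
        simpa only [Function.comp_apply, leftTranslate_pure] using this
      refine ht.eventually (lt_mem_nhds ?_)
      have h4 := h2 ⟨ω, hω⟩
      rw [Complex.re_sum] at h4
      have h5 : ∑ j, ((f j) ⟨ω, hω⟩ - (X.leftAct j (f j)) ⟨ω, hω⟩).re =
          ∑ j : S, (G j ω - G j (leftTranslate (j : Γ)⁻¹ ω)) := by
        refine Finset.sum_congr rfl fun j _ => ?_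
        rw [Complex.sub_re]
        exact congrArg₂ (· - ·) (hG2 j ⟨ω, hω⟩).symm (hG2 j (X.leftMap (j : Γ)⁻¹ ⟨ω, hω⟩)).symm
      rw [h5] at h4
      linarith [min_le_left (c / 2) (1 / ((n : ℝ) + 1))]
    have hev2 : ∀ j, ∀ k ∈ Finset.range (n + 1), ∀ᶠ x in (ω : Filter Γ),
        |G j (pure (x * e k)) - G j (pure x)| < 1 / ((n : ℝ) + 1) := by
      intro j k hk
      have ht : Tendsto (fun x => |G j (pure (x * e k)) - G j (pure x)|) ω
          (𝓝 |G j (rightTranslate (e k) ω) - G j ω|) := by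
        refine (Tendsto.sub ?_ (tendsto_apply_pure (G j).continuous ω)).abs
        have := tendsto_apply_pure ((G j).continuous.comp (continuous_rightTranslate (e k))) ω
        simpa only [Function.comp_apply, rightTranslate_pure] using this
      refine ht.eventually (gt_mem_nhds ?_)
      have h4 := norm_rightAct_sub_apply (f j) (e k) (h3 j (e k) (Finset.mem_image_of_mem e hk))
        ⟨ω, hω⟩
      rw [← hG2, ← hG2] at h4
      exact h4.trans_le (min_le_right _ _)
    have hev3 : ∀ᶠ x in (ω : Filter Γ), ∀ j, ∀ k ∈ Finset.range (n + 1),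
        |G j (pure (x * e k)) - G j (pure x)| < 1 / ((n : ℝ) + 1) :=
      eventually_all.2 fun j => (eventually_all_finset _).2 (hev2 j)
    intro hmem
    obtain ⟨x, ⟨hx1, hx2⟩, hx3⟩ := ((hev1.and hev3).and hmem).exists
    exact hx3 ⟨hx1, fun j k hk => hx2 j k (Finset.mem_range.2 (Nat.lt_succ_of_le hk))⟩
  choose G hG1 hG2 using key
  exact ⟨fun j n => G n j, fun n => _, fun j n x => hG1 n j x, hG2, fun n x hx => not_not.1 hx⟩

/-- At `x` the functions with index `n < l x` are averaged, and for these `x` lies outside `T n`.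
Right translation changes the average by a mean of errors tending to `0` plus a window error `2M / l
x`. The left coboundary keeps its lower bound up to window errors. All errors vanish at `X`. -/
theorem exists_invariant_of_approx [Countable Γ] {S : Finset Γ} {M c : ℝ} (hc : 0 < c) (hM : 0 ≤ M)
    (h : ∀ (F : Finset Γ) (ε : ℝ), 0 < ε →
      ∃ f : S → C(X.carrier, ℂ), (∀ j, ‖f j‖ ≤ M) ∧
        (∀ ω, c - ε < (∑ j, (f j ω - X.leftAct j (f j) ω)).re) ∧
        ∀ j, ∀ k ∈ F, ‖f j - X.rightAct k (f j)‖ < ε) :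
    ∃ U : S → X.rightInvariant, ∀ ω, ((c / 2 : ℝ) : ℂ) ≤
      ∑ j, ((U j : C(X.carrier, ℂ)) ω - X.leftAct j (U j : C(X.carrier, ℂ)) ω) := by
  obtain ⟨e, he⟩ := exists_surjective_nat Γ
  obtain ⟨G, T, hG, hT, hGT⟩ := exists_approx_sequence hc e h
  obtain ⟨l, hl1, hl2, hl3⟩ := exists_length e he T hT
  have hclose_right : ∀ k, ∃ N, ∀ x, N < l x → l x ≤ l (x * k) + 1 ∧ l (x * k) ≤ l x + 1 := by
    intro k
    obtain ⟨N, hN⟩ := hl3 k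
    obtain ⟨N', hN'⟩ := hl3 k⁻¹
    -- Beyond this threshold neither maximum is attained by its constant, so the bounds for `k` and
    -- `k⁻¹` give a two-sided estimate.
    refine ⟨N + N' + 1, fun x hx => ?_⟩
    have h1 := (hN x).1
    have h2 := (hN' (x * k)).1
    rw [mul_inv_cancel_right] at h2
    omega
  have hclose_left : ∀ k, ∃ N, ∀ x, N < l x → l x ≤ l (k * x) + 1 ∧ l (k * x) ≤ l x + 1 := by
    intro k
    obtain ⟨N, hN⟩ := hl3 k
    obtain ⟨N', hN'⟩ := hl3 k⁻¹
    refine ⟨N + N' + 1, fun x hx => ?_⟩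
    have h1 := (hN x).2
    have h2 := (hN' (k * x)).2
    rw [inv_mul_cancel_left] at h2
    omega
  have hlim : ∀ ω ∈ X.carrier, Tendsto (fun x => 2 * M / (l x : ℝ)) ω (𝓝 0) := fun ω hω =>
    (tendsto_const_div_atTop_nhds_zero_nat (2 * M)).comp (hl1 ω hω)
  let u : S → Γ → ℝ := fun j x => cesaroMean (l x) fun n => G j n x
  have hu : ∀ j x, |u j x| ≤ M := fun j x => abs_cesaroMean_le_of_le hM (fun n => hG j n x) _
  have hu' : ∀ j x, ‖(u j x : ℂ)‖ ≤ M := fun j x => by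
    rw [Complex.norm_real]
    exact hu j x
  have hinv : ∀ j k, ∀ ω ∈ X.carrier, Tendsto (fun x => u j (x * k) - u j x) ω (𝓝 0) := by
    intro j k ω hω
    obtain ⟨i, rfl⟩ := he k
    obtain ⟨N, hN⟩ := hclose_right (e i)
    -- The first `i` functions carry no estimate for `e i`, so the trivial bound `2 * M` is used;
    -- finitely many terms do not affect the Cesàro limit.
    let d : ℕ → ℝ := fun n => if n < i then 2 * M else 1 / ((n : ℝ) + 1)
    have hd : Tendsto d atTop (𝓝 0) := by
      refine tendsto_one_div_add_atTop_nhds_zero_nat.congr' ?_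
      filter_upwards [eventually_ge_atTop i] with n hn
      exact (if_neg (not_lt.2 hn)).symm
    have hd' : Tendsto (fun x => cesaroMean (l x) d) ω (𝓝 0) := hd.cesaro.comp (hl1 ω hω)
    have hsum := (hlim ω hω).add hd'
    rw [add_zero] at hsum
    refine squeeze_zero_norm' ?_ hsum
    filter_upwards [(hl1 ω hω).eventually_gt_atTop N] with x hx
    obtain ⟨h1, h2⟩ := hN x hx
    have hpos : 0 < l x := by omega
    have e1 := abs_cesaroMean_sub_le hM (fun n => hG j n (x * e i)) hpos h1 h2
    have e2 : |cesaroMean (l x) (fun n => G j n (x * e i)) - u j x| ≤ cesaroMean (l x) d := by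
      change |_ - cesaroMean (l x) fun n => G j n x| ≤ _
      rw [← cesaroMean_sub]
      refine (abs_cesaroMean_le _ _).trans (cesaroMean_mono fun n hn => ?_)
      by_cases hni : n < i
      · simp only [d, if_pos hni]
        have := abs_sub (G j n (x * e i)) (G j n x)
        linarith [hG j n (x * e i), hG j n x]
      · simp only [d, if_neg hni]
        exact ((hGT n x (hl2 n x hn)).2 j i (not_lt.1 hni)).le
    rw [Real.norm_eq_abs]
    exact (abs_sub_le _ (cesaroMean (l x) fun n => G j n (x * e i)) _).trans (add_le_add e1 e2)
  let U : S → C(X.carrier, ℂ) := fun j =>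
    (ultrafilterExtend fun x => (u j x : ℂ)).restrict X.carrier
  have hUinv : ∀ j, U j ∈ X.rightInvariant := by
    intro j k
    ext ω
    change ultrafilterExtend _ (rightTranslate k ω.1) = ultrafilterExtend _ ω.1
    have h1 := ((tendsto_ultrafilterExtend (hu' j) (rightTranslate k ω.1)))
    have h2 := (tendsto_map'_iff.1 h1).sub (tendsto_ultrafilterExtend (hu' j) ω.1)
    have h3 := (Complex.continuous_ofReal.tendsto 0).comp (hinv j k ω.1 ω.2)
    refine sub_eq_zero.1 (tendsto_nhds_unique h2 ?_)
    refine (h3.congr fun x => ?_)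
    simp
  refine ⟨fun j => ⟨U j, hUinv j⟩, fun ω => ?_⟩
  have ht : Tendsto (fun x => ((∑ j, (u j x - u j ((j : Γ)⁻¹ * x)) : ℝ) : ℂ)) ω.1
      (𝓝 (∑ j : S, (U j ω - X.leftAct j (U j) ω))) := by
    push_cast
    refine tendsto_finsetSum _ fun j _ => (tendsto_ultrafilterExtend (hu' j) ω.1).sub ?_
    exact tendsto_map'_iff.1 (tendsto_ultrafilterExtend (hu' j) (leftTranslate (j : Γ)⁻¹ ω.1))
  have hlow : Tendsto (fun x => ((c / 2 - ∑ _j : S, 2 * M / (l x : ℝ) : ℝ) : ℂ)) ω.1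
      (𝓝 ((c / 2 : ℝ) : ℂ)) := by
    have h1 := (tendsto_const_nhds (x := c / 2)).sub
      (tendsto_finsetSum Finset.univ fun (_ : S) _ => hlim ω.1 ω.2)
    rw [Finset.sum_const_zero, sub_zero] at h1
    exact (Complex.continuous_ofReal.tendsto _).comp h1
  refine le_of_tendsto_of_tendsto hlow ht ?_
  choose N hN using fun j : S => hclose_left (j : Γ)⁻¹
  have hev : ∀ᶠ x in (ω.1 : Filter Γ), 0 < l x ∧ ∀ j, N j < l x :=
    ((hl1 ω.1 ω.2).eventually_gt_atTop 0).and
      (eventually_all.2 fun j => (hl1 ω.1 ω.2).eventually_gt_atTop (N j))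
  filter_upwards [hev] with x hx
  refine Complex.real_le_real.2 ?_
  have h1 : c / 2 ≤ ∑ j : S, (u j x - cesaroMean (l x) fun n => G j n ((j : Γ)⁻¹ * x)) := by
    have h2 : ∑ j : S, (u j x - cesaroMean (l x) fun n => G j n ((j : Γ)⁻¹ * x)) =
        cesaroMean (l x) fun n => ∑ j : S, (G j n x - G j n ((j : Γ)⁻¹ * x)) := by
      rw [cesaroMean_sum]
      exact Finset.sum_congr rfl fun j _ => (cesaroMean_sub _ _ _).symm
    rw [h2, ← cesaroMean_const hx.1 (c / 2)]
    exact cesaroMean_mono fun n hn => (hGT n x (hl2 n x hn)).1.le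
  have h3 : ∑ j : S, (u j x - cesaroMean (l x) fun n => G j n ((j : Γ)⁻¹ * x)) -
      ∑ _j : S, 2 * M / (l x : ℝ) ≤ ∑ j : S, (u j x - u j ((j : Γ)⁻¹ * x)) := by
    rw [← Finset.sum_sub_distrib]
    refine Finset.sum_le_sum fun j _ => ?_
    obtain ⟨h4, h5⟩ := hN j x (hx.2 j)
    have h6 := (abs_le.1 (abs_cesaroMean_sub_le hM (fun n => hG j n ((j : Γ)⁻¹ * x)) hx.1 h4 h5)).2
    change u j ((j : Γ)⁻¹ * x) - _ ≤ _ at h6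
    linarith
  linarith

/-- An invariant state vanishes on the coboundary `W`, although `W - c / 2` is of the form `s* s`
with `s` right-invariant. -/
theorem not_hasInvariantState_of_bidual [Countable Γ] (h : ¬ X.HasInvariantStateBidual) :
    ¬ X.HasInvariantState := by
  rintro ⟨φ, hφ, hφinv⟩
  obtain ⟨S, M, c, hc, hM, happ⟩ := exists_approx_of_not_hasInvariantStateBidual h
  obtain ⟨U, hU⟩ := exists_invariant_of_approx hc hM happ
  let W : X.rightInvariant := ∑ j, (U j - X.leftActInvariant j (U j))
  have hW : ∀ ω, (W : C(X.carrier, ℂ)) ω =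
      ∑ j, ((U j : C(X.carrier, ℂ)) ω - X.leftAct j (U j : C(X.carrier, ℂ)) ω) := fun ω => by
    simp only [W, AddSubmonoidClass.coe_finsetSum, ContinuousMap.sum_apply]
    rfl
  have hφW : φ W = 0 := by
    simp only [W, map_sum, map_sub, hφinv, sub_self, Finset.sum_const_zero]
  let B : X.rightInvariant := W - ((c / 2 : ℝ) : ℂ) • 1
  have hB : ∀ ω, 0 ≤ (B : C(X.carrier, ℂ)) ω := fun ω => by
    have h1 : (B : C(X.carrier, ℂ)) ω = (W : C(X.carrier, ℂ)) ω - ((c / 2 : ℝ) : ℂ) * 1 := rfl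
    rw [h1, hW, mul_one]
    exact sub_nonneg.2 (hU ω)
  obtain ⟨s, hs, hsB⟩ := (B : C(X.carrier, ℂ)).exists_star_mul_self hB
  have hsinv : s ∈ X.rightInvariant := fun k => by
    ext ω
    exact hsB _ _ (DFunLike.congr_fun (B.2 k) ω)
  have h1 := hφ.nonneg ⟨s, hsinv⟩
  have h2 : star (⟨s, hsinv⟩ : X.rightInvariant) * ⟨s, hsinv⟩ = B := Subtype.ext hs
  rw [h2, map_sub, map_smul, hφW, hφ.map_one, zero_sub, smul_eq_mul, mul_one] at h1
  have h3 := (Complex.le_def.1 h1).1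
  rw [Complex.neg_re, Complex.ofReal_re, Complex.zero_re] at h3
  linarith

theorem tfae_of_nonempty [Countable Γ] (hX : X.carrier.Nonempty) :
    List.TFAE [CoveredByProximal.{u, max u v} X, EqProximal.{u, max u v} X,
      ¬ X.HasInvariantState, ¬ X.HasInvariantStateBidual] := by
  tfae_have 3 → 2 := eqProximal_of_not_hasInvariantState.{u, v} hX
  tfae_have 2 → 1 := fun ⟨A, hA, h⟩ => ⟨1, fun _ => A, fun _ => hA,
    h.le.trans (Set.subset_iUnion (fun _ : Fin 1 => A.proximalPiece) 0)⟩
  tfae_have 1 → 4 := not_hasInvariantStateBidual_of_covered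
  tfae_have 4 → 3 := not_hasInvariantState_of_bidual
  tfae_finish

end BoundaryPiece

/-! ### The whole boundary and proper proximality -/

theorem stoneCechBoundary_nonempty (Γ : Type u) [Infinite Γ] : (stoneCechBoundary Γ).Nonempty := by
  refine ⟨hyperfilter Γ, ?_⟩
  rintro ⟨x, hx⟩
  have h : ({x} : Set Γ) ∈ (pure x : Ultrafilter Γ) := Set.mem_singleton x
  rw [hx] at h
  exact (Set.finite_singleton x).notMem_hyperfilter h

end

theorem mainTheorem5 (Γ : Type u) [Group Γ] [Countable Γ] :
    (∀ X : BoundaryPiece Γ, X.carrier.Nonempty →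
      List.TFAE [
        BoundaryPiece.CoveredByProximal.{u, max u v} X,
        BoundaryPiece.EqProximal.{u, max u v} X,
        ¬ X.HasInvariantState,
        ¬ X.HasInvariantStateBidual]) ∧
    (Infinite Γ →
      List.TFAE [
        ProperlyProximal.{u, max u v} Γ,
        BoundaryPiece.CoveredByProximal.{u, max u v} (BoundaryPiece.whole Γ),
        BoundaryPiece.EqProximal.{u, max u v} (BoundaryPiece.whole Γ),
        ¬ (BoundaryPiece.whole Γ).HasInvariantState,
        ¬ (BoundaryPiece.whole Γ).HasInvariantStateBidual]) := by
  refine ⟨fun X hX => BoundaryPiece.tfae_of_nonempty.{u, v} hX, fun _ => ?_⟩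
  have h := BoundaryPiece.tfae_of_nonempty.{u, v} (X := BoundaryPiece.whole Γ)
    (stoneCechBoundary_nonempty Γ)
  -- Proper proximality lies between being one proximal piece and being covered by finitely many,
  -- which are equivalent conditions.
  tfae_have 1 → 2 := fun ⟨k, A, _, hA, hcov⟩ => ⟨k, A, hA, hcov.ge⟩
  tfae_have 3 → 1 := fun ⟨A, hA, hcov⟩ =>
    ⟨1, fun _ => A, one_pos, fun _ => hA, (Set.iUnion_const _).trans hcov.symm⟩
  tfae_have 2 ↔ 3 := h.out 0 1
  tfae_have 3 ↔ 4 := h.out 1 2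
  tfae_have 4 ↔ 5 := h.out 2 3
  tfae_finish
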